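/- Let $\Bbbk$ be a field and let $S\subseteq\mathbb Z_{\ge 0}$ be a numerical semigroup (a submonoid of $(\mathbb Z_{\ge 0},+)$ with finite complement) with multiplicity $m=\min(S\setminus\{0\})$, Apéry set $\mathrm{Ap}(S)=\{n\in S: n-m\notin S\}=\{0,a_1,\dots,a_{m-1}\}$ with $a_i\equiv i \bmod m$, and minimal generating set $\mathcal A(S)$; put $a_0=m$. Let $R=\Bbbk[x_0,\dots,x_{m-1}]$, graded by $\deg x_i=a_i$. Let $J_S$ (the Apéry ideal) be the kernel of $R\to\Bbbk[t]$, $x_i\mapsto t^{a_i}$, and let $I_S=J_S\cap\Bbbk[x_i: a_i\in\mathcal A(S)]$ be the defining toric ideal, which is considered as an ideal of $R$ by passing to the ideal $I_SR$ that it generates. By a minimal free resolution of an ideal $I\subseteq R$ we mean a graded minimal free resolution of $R/I$ over $R$. Let $W=\{w : 0\le w\le m-1,\ a_w\notin\mathcal A(S)\}$. For every $w\in W$ there are indices $u,v$ with $a_u+a_v=a_w$. For each $w\in W$ choose any such $u=u(w)$, $v=v(w)$, and let $f_w=x_w-x_{u}x_{v}$. Then the elements $f_w$ $(w\in W)$ form,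 in any order, a regular sequence on $R$; and if $\mathcal K_\bullet$ is the Koszul complex over $R$ on $(f_w)_{w\in W}$ and $\mathcal G_\bullet$ is any minimal free resolution of $I_SR$, then $\mathcal G_\bullet\otimes_R\mathcal K_\bullet$ is a minimal free resolution of $J_S$. -/

import Mathlib

open CategoryTheory MonoidalCategory

universe u

noncomputable section

/-! ## Numerical semigroups

A numerical semigroup is an additive submonoid `S` of `ℕ` with finite complement. -/

namespace NumericalSemigroup

/-- The multiplicity `m = min (S \ {0})`. -/
def mult (S : AddSubmonoid ℕ) : ℕ := sInf {n | n ∈ S ∧ n ≠ 0}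

/-- The Apéry set `{n ∈ S : n - m ∉ S}`, where `n - m` is the difference of integers and `m` is
the multiplicity: `n` is not of the form `s + m` with `s ∈ S`. -/
def aperySet (S : AddSubmonoid ℕ) : Set ℕ :=
  {n | n ∈ S ∧ ∀ s ∈ S, n ≠ s + mult S}

/-- The numbers `a_0, …, a_{m-1}`: `a_0 = m`, and for `i ≠ 0` the number `a_i` is the (only)
element of the Apéry set that is congruent to `i` modulo `m`. -/
def aperyGen (S : AddSubmonoid ℕ) (i : Fin (mult S)) : ℕ :=
  if (i : ℕ) = 0 then mult S
  else sInf {n | n ∈ aperySet S ∧ n ≡ (i : ℕ) [MOD mult S]}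

/-- The minimal generating set of `S`: the nonzero elements of `S` that are not the sum of
two nonzero elements of `S`. By `isLeast_minimalGenerators` it is the least generating set. -/
def minimalGenerators (S : AddSubmonoid ℕ) : Set ℕ :=
  {n | n ∈ S ∧ n ≠ 0 ∧ ∀ s ∈ S, ∀ t ∈ S, s ≠ 0 → t ≠ 0 → n ≠ s + t}

theorem isLeast_minimalGenerators (S : AddSubmonoid ℕ) :
    IsLeast {T : Set ℕ | AddSubmonoid.closure T = S} (minimalGenerators S) := by
  constructor
  · apply le_antisymm
    · exact (AddSubmonoid.closure_le).2 fun n hn => hn.1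
    · intro n
      induction n using Nat.strong_induction_on with
      | _ n ih =>
        intro hn
        by_cases h0 : n = 0
        · subst h0; exact zero_mem _
        by_cases h : ∀ s ∈ S, ∀ t ∈ S, s ≠ 0 → t ≠ 0 → n ≠ s + t
        · exact AddSubmonoid.subset_closure ⟨hn, h0, h⟩
        · push Not at h
          obtain ⟨s, hs, t, ht, hs0, ht0, rfl⟩ := h
          exact add_mem (ih s (by omega) hs) (ih t (by omega) ht)
  · rintro T rfl n ⟨hn, h0, h⟩
    have key : ∀ x ∈ AddSubmonoid.closure T,
        x = 0 ∨ x ∈ T ∨ ∃ s ∈ AddSubmonoid.closure T, ∃ t ∈ AddSubmonoid.closure T,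
          s ≠ 0 ∧ t ≠ 0 ∧ x = s + t := by
      intro x hx
      induction hx using AddSubmonoid.closure_induction with
      | mem x hx => exact Or.inr (Or.inl hx)
      | zero => exact Or.inl rfl
      | add x y hx hy ihx ihy =>
        by_cases hx0 : x = 0
        · simpa [hx0] using ihy
        by_cases hy0 : y = 0
        · simpa [hy0] using ihx
        exact Or.inr (Or.inr ⟨x, hx, y, hy, hx0, hy0, rfl⟩)
    rcases key n hn with h1 | h1 | ⟨s, hs, t, ht, hs0, ht0, e⟩
    · exact absurd h1 h0
    · exact h1
    · exact absurd e (h s hs t ht hs0 ht0)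

/-- The indices `i` for which `a_i` is a minimal generator of `S`. -/
abbrev MinIndex (S : AddSubmonoid ℕ) : Type :=
  {i : Fin (mult S) // aperyGen S i ∈ minimalGenerators S}

/-- The indices `w` for which `a_w` is not a minimal generator of `S`. As `a_0 = m` is a minimal
generator, these are the indices of the nonzero elements of the Apéry set that are not minimal
generators. -/
abbrev ExtraIndex (S : AddSubmonoid ℕ) : Type :=
  {i : Fin (mult S) // aperyGen S i ∉ minimalGenerators S}

/-- The Apéry toric ideal `J_S`, the kernel of `k[x_0, …, x_{m-1}] → k[t]`, `x_i ↦ t ^ a_i`. -/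
def aperyIdeal (k : Type*) [Field k] (S : AddSubmonoid ℕ) :
    Ideal (MvPolynomial (Fin (mult S)) k) :=
  RingHom.ker (MvPolynomial.aeval (R := k)
    (fun i => (Polynomial.X : Polynomial k) ^ aperyGen S i))

/-- The defining toric ideal `I_S = J_S ∩ k[x_i : a_i is a minimal generator]`, as an ideal of the
polynomial ring in the variables that correspond to minimal generators. -/
def toricIdeal (k : Type*) [Field k] (S : AddSubmonoid ℕ) :
    Ideal (MvPolynomial (MinIndex S) k) :=
  (aperyIdeal k S).comap (MvPolynomial.rename Subtype.val : MvPolynomial (MinIndex S) k →ₐ[k] _)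

/-- The defining toric ideal, considered as an ideal of `k[x_0, …, x_{m-1}]` (the ideal generated
by the image of `I_S` under the inclusion of polynomial rings). -/
def toricIdealExt (k : Type*) [Field k] (S : AddSubmonoid ℕ) :
    Ideal (MvPolynomial (Fin (mult S)) k) :=
  (toricIdeal k S).map (MvPolynomial.rename Subtype.val : MvPolynomial (MinIndex S) k →ₐ[k] _)

end NumericalSemigroup

/-! ## The Koszul complex of a finite family of ring elements -/

namespace Koszul

variable {R W : Type*} [CommRing R] [LinearOrder W]

/-- The sign `(-1) ^ t` if `j` is the `t`-th element of `A`, counted from `0`. -/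
def sign (R : Type*) [CommRing R] (j : W) (A : Finset W) : R := (-1) ^ (A.filter (· < j)).card

/-- The free module with basis the `n`-element subsets of `W`. -/
abbrev Chains (R W : Type*) [CommRing R] (n : ℕ) : Type _ := {A : Finset W // A.card = n} →₀ R

/-- The Koszul differential `e_A ↦ ∑ j ∈ A, sign (j, A) * f j * e_{A \ j}`. -/
def differential (f : W → R) (n : ℕ) : Chains R W (n + 1) →ₗ[R] Chains R W n :=
  Finsupp.linearCombination R fun A =>
    ∑ j ∈ A.1.attach, Finsupp.single
      ⟨A.1.erase j, by rw [Finset.card_erase_of_mem j.2, A.2, Nat.add_sub_cancel]⟩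
      (sign R (j : W) A.1 * f j)

theorem sign_mul_sign_erase {A : Finset W} {i j : W} (hi : i ∈ A) (h : i < j) :
    sign R i A * sign R j (A.erase i) = -(sign R j A * sign R i (A.erase j)) := by
  have h1 : (A.erase i).filter (· < j) = (A.filter (· < j)).erase i := by
    rw [Finset.filter_erase]
  have h2 : (A.erase j).filter (· < i) = A.filter (· < i) := by
    rw [Finset.filter_erase, Finset.erase_eq_of_notMem]
    simp [h.le]
  have h3 : i ∈ A.filter (· < j) := by simp [hi, h]
  have h4 : (A.filter (· < j)).card = ((A.filter (· < j)).erase i).card + 1 :=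
    (Finset.card_erase_add_one h3).symm
  unfold sign
  rw [h1, h2, h4, pow_succ]
  ring

theorem differential_comp (f : W → R) (n : ℕ) :
    (differential f n).comp (differential f (n + 1)) = 0 := by
  let v (m : ℕ) : Chains R W m →ₗ[R] (Finset W →₀ R) := Finsupp.lmapDomain R R Subtype.val
  let D : (Finset W →₀ R) →ₗ[R] (Finset W →₀ R) := Finsupp.linearCombination R fun A =>
    ∑ j ∈ A, Finsupp.single (A.erase j) (sign R j A * f j)
  have hv (m : ℕ) : Function.Injective (v m) :=
    Finsupp.mapDomain_injective Subtype.val_injective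
  have hD (m : ℕ) (z : Chains R W (m + 1)) : v m (differential f m z) = D (v (m + 1) z) := by
    induction z using Finsupp.induction_linear with
    | zero => simp
    | add x y hx hy => simp only [map_add, hx, hy]
    | single A r =>
      simp only [v, D, differential, Finsupp.linearCombination_single, map_smul,
        Finsupp.lmapDomain_apply, Finsupp.mapDomain_single, map_sum]
      congr 1
      exact Finset.sum_attach A.1 fun j => Finsupp.single (A.1.erase j) (sign R j A.1 * f j)
  have hDD (z : Finset W →₀ R) : D (D z) = 0 := by
    induction z using Finsupp.induction_linear with
    | zero => simp
    | add x y hx hy => simp only [map_add, hx, hy, add_zero]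
    | single A r =>
      simp only [D, Finsupp.linearCombination_single, map_smul, map_sum]
      convert smul_zero r
      simp only [Finset.smul_sum, Finsupp.smul_single, smul_eq_mul]
      rw [Finset.sum_sigma']
      refine Finset.sum_involution (fun p _ => ⟨p.2, p.1⟩) ?_ ?_ ?_ ?_
      · rintro ⟨i, j⟩ hp
        simp only [Finset.mem_sigma, Finset.mem_erase] at hp
        rw [Finset.erase_right_comm, ← Finsupp.single_add]
        refine (congrArg _ ?_).trans (Finsupp.single_zero _)
        dsimp only
        rcases lt_or_gt_of_ne hp.2.1 with h | h
        · have := sign_mul_sign_erase (R := R) hp.2.2 h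
          linear_combination (f i * f j) * this
        · have := sign_mul_sign_erase (R := R) hp.1 h
          linear_combination (f i * f j) * this
      · rintro ⟨i, j⟩ hp _ h
        simp only [Finset.mem_sigma, Finset.mem_erase] at hp
        exact hp.2.1 (congrArg Sigma.fst h)
      · rintro ⟨i, j⟩ hp
        simp only [Finset.mem_sigma, Finset.mem_erase] at hp ⊢
        exact ⟨hp.2.2, fun h => hp.2.1 h.symm, hp.1⟩
      · rintro ⟨i, j⟩ _
        rfl
  ext1 A
  refine LinearMap.ext fun r => hv n ?_
  simp only [LinearMap.comp_apply, hD, hDD, LinearMap.zero_apply, map_zero]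

/-- The Koszul complex of a family `f` of elements of `R`; in degree `n` it is the free module
with basis the `n`-element subsets of the index set. -/
def complex {R : Type*} {W : Type} [CommRing R] [LinearOrder W] (f : W → R) :
    ChainComplex (ModuleCat R) ℕ :=
  ChainComplex.of (fun n => ModuleCat.of R (Chains R W n))
    (fun n => ModuleCat.ofHom (differential f n))
    (fun n => by rw [← ModuleCat.ofHom_comp, differential_comp]; rfl)

end Koszul

/-! ## Minimal graded free resolutions -/

/-- `C` is a minimal graded free resolution of the `k[x]`-module `k[x] ⧸ J`, for the grading of the
polynomial ring in which `x i` has degree `w i`. This means that there are finite bases `b n` of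
the modules of `C`, degrees `deg n i` of their elements and an augmentation `ε` such that
* the differentials and the augmentation are homogeneous of degree `0`;
* `⋯ → C_2 → C_1 → C_0 → k[x] ⧸ J → 0` is exact;
* the image of each differential lies in `(x) C`, where `(x)` is the ideal generated by the
  variables. -/
def IsMinimalGradedFreeResolution {σ : Type} {k : Type u} [Field k] (w : σ → ℤ)
    (J : Ideal (MvPolynomial σ k)) (C : ChainComplex (ModuleCat.{u} (MvPolynomial σ k)) ℕ) :
    Prop :=
  ∃ (ι : ℕ → Type) (_ : ∀ n, Finite (ι n))
    (b : ∀ n, Module.Basis (ι n) (MvPolynomial σ k) (C.X n))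
    (deg : ∀ n, ι n → ℤ)
    (ε : C.X 0 →ₗ[MvPolynomial σ k] MvPolynomial σ k ⧸ J),
    (∀ n i j, MvPolynomial.IsWeightedHomogeneous w
      ((b n).repr ((C.d (n + 1) n).hom (b (n + 1) j)) i) (deg (n + 1) j - deg n i)) ∧
    (∀ i, ∃ p : MvPolynomial σ k, MvPolynomial.IsWeightedHomogeneous w p (deg 0 i) ∧
      ε (b 0 i) = Ideal.Quotient.mk J p) ∧
    Function.Surjective ε ∧
    Function.Exact (C.d 1 0).hom ε ∧
    (∀ n, Function.Exact (C.d (n + 2) (n + 1)).hom (C.d (n + 1) n).hom) ∧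
    (∀ n, LinearMap.range (C.d (n + 1) n).hom ≤
      Ideal.span (Set.range (MvPolynomial.X : σ → MvPolynomial σ k)) •
        (⊤ : Submodule (MvPolynomial σ k) (C.X n)))

end

open NumericalSemigroup

/-! Because all `a_i` are positive, `a_u + a_v = a_w` forces `u` and `v` to have smaller degree than
`w`, so `f_w` eliminates `x_w` in favour of variables of smaller degree. For a set `T` of extra
indices, recursive elimination of the `x_w` with `w ∈ T` gives an endomorphism `ψ` of `R` that kills
these `f_w`, fixes the variables of the minimal generators, and is the identity modulo `(f_T)`.
Hence `PR + (f_T) = ψ⁻¹(PR)` for every ideal `P` in the minimal variables, and this is prime if `P`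
is (`isPrime_map_rename_sup_span`).

If `P` vanishes at the point `x_i = t ^ a_i` and `j ∉ T`, then `f_j ∉ PR + (f_T)`: replace the
`j`-th coordinate by `t ^ a_j + 1` and recompute the other extra coordinates from their relations.
The ideal vanishes at the new point, while `f_j` takes the value 1 (`notMem_map_rename_sup_span`).
An element outside a prime ideal is a nonzerodivisor modulo it, so the `f_w` are regular in any
order on `R ⧸ PR`. The case `P = 0` is the first claim; `P = I_S` is the input for the second.
Eliminating all extra variables also gives `J_S = I_S R + (f)` (`ker_aeval_eq_map_rename_sup_span`).

The rest is homological. A sequence regular in every order on `M = R ⧸ I` has acyclic Koszul complex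
over `M` (`exists_contract_eq`), and a zigzag transfers this to `G ⊗ K` for a resolution `G` of `M`
(`exists_totalDifferential_eq`). For this, an element of `G ⊗ K` is written as a family `c i A ∈
G_i` indexed by subsets `A`. The differential has entries from `G` and `± f_w`, all in `(x)`, whence
minimality; and `g ⊗ e_A` has degree `deg g + ∑_{w ∈ A} a_w`, whence the grading. -/

namespace NumericalSemigroup

/-! ### Recursive elimination of variables -/

section Substitution

variable {σ : Type*} {p : σ → Prop} {A : Type*} [CommRing A]
  (a : σ → ℕ) {u v : {i // ¬ p i} → σ}

open Classical in
/-- The values `y i` that agree with `y₀` off `T` and satisfy `y w = y (u w) * y (v w)` for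
`w ∈ T`. -/
noncomputable def substValue (hu : ∀ w, a (u w) < a w) (hv : ∀ w, a (v w) < a w)
    (T : Set {i // ¬ p i}) (y₀ : σ → A) (i : σ) : A :=
  if h : ∃ h : ¬ p i, (⟨i, h⟩ : {i // ¬ p i}) ∈ T then
    substValue hu hv T y₀ (u ⟨i, h.1⟩) * substValue hu hv T y₀ (v ⟨i, h.1⟩)
  else y₀ i
termination_by a i
decreasing_by
  · exact hu ⟨i, h.1⟩
  · exact hv ⟨i, h.1⟩

variable {a} (hu : ∀ w, a (u w) < a w) (hv : ∀ w, a (v w) < a w)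
  (T : Set {i // ¬ p i}) (y₀ : σ → A)

theorem substValue_of_mem (w : {i // ¬ p i}) (hw : w ∈ T) :
    substValue a hu hv T y₀ w =
      substValue a hu hv T y₀ (u w) * substValue a hu hv T y₀ (v w) := by
  rw [substValue, dif_pos ⟨w.2, hw⟩]

theorem substValue_of_notMem (w : {i // ¬ p i}) (hw : w ∉ T) :
    substValue a hu hv T y₀ w = y₀ w := by
  rw [substValue, dif_neg]
  rintro ⟨_, h⟩
  exact hw h

theorem substValue_of_prop (i : σ) (hi : p i) : substValue a hu hv T y₀ i = y₀ i := by
  rw [substValue, dif_neg]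
  rintro ⟨h, _⟩
  exact h hi

end Substitution

/-! ### Primality, non-membership and generation for the ideals `PR + (f_T)` -/

section Ideals

open MvPolynomial

variable {σ : Type*} {k : Type*} [Field k] {p : σ → Prop}

theorem isPrime_map_of_comp_ringEquiv {A B C : Type*} [CommRing A] [CommRing B] [CommRing C]
    (P : Ideal A) (φ : A →+* B) (e : B ≃+* C) (h : (P.map ((e : B →+* C).comp φ)).IsPrime) :
    (P.map φ).IsPrime := by
  rw [← Ideal.map_map] at h
  have h2 : (P.map φ) = ((P.map φ).map (e : B →+* C)).comap (e : B →+* C) :=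
    (Ideal.comap_map_of_bijective (e : B →+* C) e.bijective).symm
  rw [h2]
  exact Ideal.comap_isPrime _ _

/-- Viewing the larger ring as polynomials over the smaller one turns the inclusion into `C`, and
the extension of `P` along `C` is the kernel of the reduction of coefficients to the domain `A ⧸ P`,
with `A` the smaller ring. -/
theorem isPrime_map_rename (P : Ideal (MvPolynomial {i // p i} k)) [P.IsPrime] :
    (P.map (rename Subtype.val : MvPolynomial {i // p i} k →ₐ[k] MvPolynomial σ k)).IsPrime := by
  classical
  let e : MvPolynomial σ k ≃ₐ[k] MvPolynomial {i // ¬ p i} (MvPolynomial {i // p i} k) :=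
    (renameEquiv k ((Equiv.sumCompl p).symm.trans (Equiv.sumComm _ _))).trans
      (sumAlgEquiv k _ _)
  have he : e.toRingEquiv.toRingHom.comp
      (rename Subtype.val : MvPolynomial {i // p i} k →ₐ[k] MvPolynomial σ k).toRingHom = C := by
    refine MvPolynomial.ringHom_ext (fun r => ?_) fun i => ?_
    · simp [e]
    · simp [e, Equiv.sumCompl_symm_apply_of_pos i.2]
  have hC : (P.map (C : _ →+* MvPolynomial {i // ¬ p i} (MvPolynomial {i // p i} k))).IsPrime := by
    have := ker_map (σ := {i // ¬ p i}) (Ideal.Quotient.mk P)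
    rw [Ideal.mk_ker] at this
    rw [← this]
    exact RingHom.ker_isPrime _
  exact isPrime_map_of_comp_ringEquiv P _ e.toRingEquiv (he ▸ hC)

variable {a : σ → ℕ} {u v : {i // ¬ p i} → σ} (hu : ∀ w, a (u w) < a w) (hv : ∀ w, a (v w) < a w)
  {f : {i // ¬ p i} → MvPolynomial σ k} (hf : ∀ w, f w = X (w : σ) - X (u w) * X (v w))

-- Modulo the `f w` with `w ∈ T`, each `X w` equals `X (u w) * X (v w)`, so by induction on the
-- degree every variable is congruent to its substituted value.
include hf in
theorem sub_substValue_mem_span (T : Set {i // ¬ p i}) (q : MvPolynomial σ k) :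
    q - aeval (substValue a hu hv T (X : σ → MvPolynomial σ k)) q ∈ Ideal.span (f '' T) := by
  set y := substValue a hu hv T (X : σ → MvPolynomial σ k) with hy
  have key : ∀ n, ∀ i, a i = n →
      Ideal.Quotient.mk (Ideal.span (f '' T)) (X i) = Ideal.Quotient.mk _ (y i) := by
    intro n
    induction n using Nat.strong_induction_on with
    | _ n ih =>
      intro i hi
      by_cases hp : p i
      · rw [hy, substValue_of_prop _ _ _ _ _ hp]
      by_cases hT : (⟨i, hp⟩ : {i // ¬ p i}) ∈ T
      · have h1 : Ideal.Quotient.mk (Ideal.span (f '' T)) (f ⟨i, hp⟩) = 0 :=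
          Ideal.Quotient.eq_zero_iff_mem.2 (Ideal.subset_span ⟨_, hT, rfl⟩)
        rw [hf, map_sub, map_mul, sub_eq_zero] at h1
        have h2 := substValue_of_mem hu hv T (X : σ → MvPolynomial σ k) ⟨i, hp⟩ hT
        dsimp only at h1 h2
        rw [h1, hy, h2, map_mul, ih _ (hi ▸ hu ⟨i, hp⟩) _ rfl, ih _ (hi ▸ hv ⟨i, hp⟩) _ rfl]
      · have h2 := substValue_of_notMem hu hv T (X : σ → MvPolynomial σ k) ⟨i, hp⟩ hT
        dsimp only at h2
        rw [hy, h2]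
  have h : (Ideal.Quotient.mkₐ k (Ideal.span (f '' T))) =
      (Ideal.Quotient.mkₐ k (Ideal.span (f '' T))).comp (aeval y) := by
    ext i
    simpa using key _ i rfl
  rw [← Ideal.Quotient.eq]
  exact DFunLike.congr_fun h q

include hf in
theorem aeval_substValue_apply {A : Type*} [CommRing A] [Algebra k A] (T : Set {i // ¬ p i})
    (y₀ : σ → A) (w : {i // ¬ p i}) (hw : w ∈ T) :
    aeval (substValue a hu hv T y₀) (f w) = 0 := by
  simp [hf, substValue_of_mem hu hv T y₀ w hw]

theorem aeval_substValue_rename {A : Type*} [CommRing A] [Algebra k A] (T : Set {i // ¬ p i})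
    (y₀ : σ → A) (q : MvPolynomial {i // p i} k) :
    aeval (substValue a hu hv T y₀) (rename Subtype.val q) = aeval (fun i : {i // p i} => y₀ i) q := by
  rw [aeval_rename]
  congr 2
  funext i
  exact substValue_of_prop hu hv T y₀ i i.2

-- The ideal is the preimage of the extension of `P` under the substitution, which fixes that
-- extension's generators, kills `f '' T`, and changes a polynomial only by an element of the span
-- of `f '' T`.
include hu hv hf in
theorem isPrime_map_rename_sup_span (P : Ideal (MvPolynomial {i // p i} k)) [P.IsPrime]
    (T : Set {i // ¬ p i}) :
    (P.map (rename Subtype.val : MvPolynomial {i // p i} k →ₐ[k] MvPolynomial σ k) ⊔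
      Ideal.span (f '' T)).IsPrime := by
  let ψ : MvPolynomial σ k →ₐ[k] MvPolynomial σ k :=
    aeval (substValue a hu hv T (X : σ → MvPolynomial σ k))
  have hψ : ∀ q, ψ (rename Subtype.val q) = rename Subtype.val q :=
    fun q =>
    (aeval_substValue_rename hu hv T (X : σ → MvPolynomial σ k) q).trans
      (DFunLike.congr_fun (show aeval (fun i : {i // p i} => (X (i : σ) : MvPolynomial σ k)) =
        rename Subtype.val by ext i; simp) q)
  let Q := P.map (rename Subtype.val : MvPolynomial {i // p i} k →ₐ[k] MvPolynomial σ k)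
  have hQ : Q.IsPrime := isPrime_map_rename P
  have h : Q ⊔ Ideal.span (f '' T) = Q.comap ψ := by
    apply le_antisymm
    · refine sup_le ?_ ?_
      · rw [Ideal.map_le_iff_le_comap]
        intro q hq
        change ψ (rename Subtype.val q) ∈ Q
        rw [hψ]
        exact Ideal.mem_map_of_mem _ hq
      · rw [Ideal.span_le]
        rintro _ ⟨w, hw, rfl⟩
        change ψ (f w) ∈ Q
        rw [aeval_substValue_apply hu hv hf T _ w hw]
        exact zero_mem _
    · intro q hq
      have h1 := sub_substValue_mem_span hu hv hf T q
      rw [← sub_add_cancel q (ψ q)]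
      exact add_mem (Ideal.mem_sup_right h1) (Ideal.mem_sup_left hq)
  change (Q ⊔ _).IsPrime
  rw [h]
  exact Ideal.comap_isPrime _ _

-- A point separates `f j` from the ideal: the monomial curve with its `j`-th coordinate increased
-- by 1 and the relations for all other extra indices restored. There `f j` takes the value 1.
include hf in
theorem notMem_map_rename_sup_span (huv : ∀ w, a (u w) + a (v w) = a w) (ha : ∀ i, 0 < a i)
    (P : Ideal (MvPolynomial {i // p i} k))
    (hP : ∀ q ∈ P, aeval (fun i : {i // p i} => (Polynomial.X : Polynomial k) ^ a i) q = 0)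
    (T : Set {i // ¬ p i}) (j : {i // ¬ p i}) (hj : j ∉ T) :
    f j ∉ P.map (rename Subtype.val : MvPolynomial {i // p i} k →ₐ[k] MvPolynomial σ k) ⊔
      Ideal.span (f '' T) := by
  classical
  have hu : ∀ w, a (u w) < a w := fun w => by have := huv w; have := ha (v w); omega
  have hv : ∀ w, a (v w) < a w := fun w => by have := huv w; have := ha (u w); omega
  let y₀ : σ → Polynomial k := fun i => if i = j then Polynomial.X ^ a j + 1 else Polynomial.X ^ a i
  let y := substValue a hu hv {j}ᶜ y₀
  let χ : MvPolynomial σ k →ₐ[k] Polynomial k := aeval y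
  -- The perturbation at `j` does not reach coordinates of smaller degree, in particular not `u j`
  -- and `v j`.
  have hy : ∀ n, n < a j → ∀ i, a i = n → y i = Polynomial.X ^ a i := by
    intro n
    induction n using Nat.strong_induction_on with
    | _ n ih =>
      intro hn i hi
      have hij : i ≠ j := by rintro rfl; omega
      by_cases hp : p i
      · simp only [y, substValue_of_prop hu hv _ y₀ i hp, y₀, if_neg hij]
      · have h2 : y i = y (u ⟨i, hp⟩) * y (v ⟨i, hp⟩) :=
          substValue_of_mem hu hv {j}ᶜ y₀ ⟨i, hp⟩ (fun h => hij (congrArg Subtype.val h))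
        have h3 := huv ⟨i, hp⟩
        have h4 := hu ⟨i, hp⟩
        have h5 := hv ⟨i, hp⟩
        dsimp only at h3 h4 h5
        rw [h2, ih _ (hi ▸ h4) (by omega) _ rfl, ih _ (hi ▸ h5) (by omega) _ rfl, ← pow_add, h3]
  have hle : P.map (rename Subtype.val : MvPolynomial {i // p i} k →ₐ[k] MvPolynomial σ k) ⊔
      Ideal.span (f '' T) ≤ RingHom.ker χ := by
    refine sup_le ?_ ?_
    · rw [Ideal.map_le_iff_le_comap]
      intro q hq
      change χ (rename Subtype.val q) = 0
      rw [← hP q hq]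
      refine (aeval_substValue_rename hu hv _ y₀ q).trans ?_
      congr 2
      funext i
      have : (i : σ) ≠ j := fun h => j.2 (h ▸ i.2)
      simp only [y₀, if_neg this]
    · rw [Ideal.span_le]
      rintro _ ⟨w, hw, rfl⟩
      refine aeval_substValue_apply hu hv hf _ y₀ w ?_
      rintro rfl
      exact hj hw
  intro hmem
  have h0 : χ (f j) = 0 := hle hmem
  have h1 : y j = Polynomial.X ^ a j + 1 :=
    (substValue_of_notMem hu hv {j}ᶜ y₀ j (fun h => h rfl)).trans (if_pos rfl)
  rw [hf] at h0
  simp only [χ, map_sub, map_mul, aeval_X, h1, hy _ (hu j) _ rfl, hy _ (hv j) _ rfl,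
    ← pow_add, huv j] at h0
  simp at h0

-- Eliminating all extra variables writes any `q ∈ J` as an element of `(f)` plus a polynomial in
-- the minimal variables; since `(f) ≤ J`, that polynomial lies in the contraction of `J`.
include hu hv hf in
theorem ker_aeval_eq_map_rename_sup_span (huv : ∀ w, a (u w) + a (v w) = a w)
    (J : Ideal (MvPolynomial σ k))
    (hJ : J = RingHom.ker (aeval (R := k) fun i => (Polynomial.X : Polynomial k) ^ a i)) :
    J = (J.comap (rename Subtype.val : MvPolynomial {i // p i} k →ₐ[k] MvPolynomial σ k)).map
        (rename Subtype.val : MvPolynomial {i // p i} k →ₐ[k] MvPolynomial σ k) ⊔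
      Ideal.span (Set.range f) := by
  classical
  have hfJ : Ideal.span (Set.range f) ≤ J := by
    rw [Ideal.span_le]
    rintro _ ⟨w, rfl⟩
    rw [hJ]
    simp [RingHom.mem_ker, hf, ← pow_add, huv]
  apply le_antisymm
  · intro q hq
    let ρ : MvPolynomial {i // p i} k →ₐ[k] MvPolynomial σ k := rename Subtype.val
    -- The value 0 off `p` is never used, since every such variable is eliminated.
    let y₀ : σ → MvPolynomial {i // p i} k := fun i => if h : p i then X ⟨i, h⟩ else 0
    let ψ := aeval (R := k) (substValue a hu hv Set.univ y₀)
    have hψ : ∀ q, ψ (ρ q) = q := fun q => by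
      refine (aeval_substValue_rename hu hv Set.univ y₀ q).trans ?_
      have : (fun i : {i // p i} => y₀ i) = X := by
        funext i
        simp only [y₀, dif_pos i.2]
      rw [this, aeval_X_left_apply]
    have hψf : Ideal.span (Set.range f) ≤ RingHom.ker ψ := by
      rw [Ideal.span_le]
      rintro _ ⟨w, rfl⟩
      exact aeval_substValue_apply hu hv hf _ y₀ w (Set.mem_univ _)
    have hmem : q - ρ (ψ q) ∈ Ideal.span (Set.range f) := by
      have key : ∀ n, ∀ i, a i = n →
          Ideal.Quotient.mk (Ideal.span (Set.range f)) (X i) = Ideal.Quotient.mk _ (ρ (ψ (X i))) := by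
        intro n
        induction n using Nat.strong_induction_on with
        | _ n ih =>
          intro i hi
          by_cases hp : p i
          · have : (X i : MvPolynomial σ k) = ρ (X ⟨i, hp⟩) := by simp [ρ]
            rw [this, hψ]
          · have h0 : f ⟨i, hp⟩ ∈ Ideal.span (Set.range f) := Ideal.subset_span ⟨_, rfl⟩
            have h1 := Ideal.Quotient.eq_zero_iff_mem.2 h0
            have h2 : ψ (f ⟨i, hp⟩) = 0 := hψf h0
            rw [hf, map_sub, map_mul, sub_eq_zero] at h1 h2
            dsimp only at h1 h2
            rw [h1, h2, map_mul, map_mul, ih _ (hi ▸ hu ⟨i, hp⟩) _ rfl,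
              ih _ (hi ▸ hv ⟨i, hp⟩) _ rfl]
      have h : (Ideal.Quotient.mkₐ k (Ideal.span (Set.range f))) =
          (Ideal.Quotient.mkₐ k (Ideal.span (Set.range f))).comp (ρ.comp ψ) := by
        ext i
        simpa using key _ i rfl
      rw [← Ideal.Quotient.eq]
      exact DFunLike.congr_fun h q
    rw [← sub_add_cancel q (ρ (ψ q))]
    refine add_mem (Ideal.mem_sup_right hmem) (Ideal.mem_sup_left (Ideal.mem_map_of_mem ρ ?_))
    change ρ (ψ q) ∈ J
    have := sub_mem hq (hfJ hmem)
    rwa [sub_sub_cancel] at this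
  · refine sup_le ?_ hfJ
    rw [Ideal.map_le_iff_le_comap]

end Ideals

end NumericalSemigroup

/-! ### Acyclicity of the Koszul complex with coefficients in a module -/

namespace Koszul

section Contract

variable {R W M N : Type*} [CommRing R] [LinearOrder W] [Fintype W] [AddCommGroup M] [Module R M]
  [AddCommGroup N] [Module R N] (f : W → R)

/-- The Koszul differential with coefficients in `M`, on families of elements of `M` indexed by
the subsets of `W`. -/
def contract : (Finset W → M) →ₗ[R] (Finset W → M) where
  toFun c A := ∑ j ∈ Aᶜ, (sign R j (insert j A) * f j) • c (insert j A)
  map_add' x y := by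
    funext A
    simp [smul_add, Finset.sum_add_distrib]
  map_smul' r x := by
    funext A
    simp only [Pi.smul_apply, RingHom.id_apply, Finset.smul_sum]
    exact Finset.sum_congr rfl fun _ _ => smul_comm _ _ _

theorem contract_apply (c : Finset W → M) (A : Finset W) :
    contract f c A = ∑ j ∈ Aᶜ, (sign R j (insert j A) * f j) • c (insert j A) := rfl

theorem map_contract (φ : M →ₗ[R] N) (c : Finset W → M) (A : Finset W) :
    φ (contract f c A) = contract f (fun B => φ (c B)) A := by
  simp [contract_apply]

omit [Fintype W] in
theorem sign_insert_mul_sign_insert {A : Finset W} {i j : W} (hi : i ∉ A) (hj : j ∉ A)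
    (hij : i ≠ j) :
    sign R j (insert j A) * sign R i (insert i (insert j A)) =
      -(sign R i (insert i A) * sign R j (insert j (insert i A))) := by
  have key : ∀ {i j : W}, i ∉ A → j ∉ A → i < j →
      sign R j (insert j A) * sign R i (insert i (insert j A)) =
      -(sign R i (insert i A) * sign R j (insert j (insert i A))) := by
    intro i j hi hj h
    have h1 := sign_mul_sign_erase (R := R) (A := insert i (insert j A))
      (Finset.mem_insert_self i _) h
    rw [Finset.erase_insert (by simp [h.ne, hi]), Finset.insert_comm i j A,
      Finset.erase_insert (by simp [h.ne', hj])] at h1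
    rw [Finset.insert_comm i j A]
    linear_combination h1
  rcases lt_or_gt_of_ne hij with h | h
  · exact key hi hj h
  · rw [key hj hi h, neg_neg]

theorem contract_contract (c : Finset W → M) : contract f (contract f c) = 0 := by
  funext A
  simp only [contract_apply, Finset.smul_sum, Pi.zero_apply]
  rw [Finset.sum_sigma']
  -- The terms for the ordered pairs `(i, j)` and `(j, i)` cancel.
  refine Finset.sum_involution (fun p _ => ⟨p.2, p.1⟩) ?_ ?_ ?_ ?_
  · rintro ⟨i, j⟩ hp
    simp only [Finset.mem_sigma, Finset.mem_compl, Finset.mem_insert, not_or] at hp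
    dsimp only
    rw [Finset.insert_comm i j A, smul_smul, smul_smul, ← add_smul]
    have h := sign_insert_mul_sign_insert (R := R) hp.2.2 hp.1 hp.2.1
    rw [Finset.insert_comm i j A] at h
    refine (congrArg (· • _) ?_).trans (zero_smul R _)
    linear_combination (f i * f j) * h
  · rintro ⟨i, j⟩ hp _ h
    simp only [Finset.mem_sigma, Finset.mem_compl, Finset.mem_insert, not_or] at hp
    exact hp.2.1 (congrArg Sigma.fst h)
  · rintro ⟨i, j⟩ hp
    simp only [Finset.mem_sigma, Finset.mem_compl, Finset.mem_insert, not_or] at hp ⊢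
    exact ⟨hp.2.2, fun h => hp.2.1 h.symm, hp.1⟩
  · rintro ⟨i, j⟩ _
    rfl

theorem contract_eq_zero_of_card {c : Finset W → M} {n : ℕ}
    (hc : ∀ A, A.card ≠ n + 1 → c A = 0) (A : Finset W) (hA : A.card ≠ n) :
    contract f c A = 0 := by
  refine Finset.sum_eq_zero fun j hj => ?_
  rw [hc, smul_zero]
  rw [Finset.card_insert_of_notMem (Finset.mem_compl.1 hj)]
  omega

theorem contract_eq_zero_of_not_subset {c : Finset W → M} {s : Finset W}
    (hc : ∀ A, ¬ A ⊆ s → c A = 0) (A : Finset W) (hA : ¬ A ⊆ s) :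
    contract f c A = 0 := by
  refine Finset.sum_eq_zero fun j _ => ?_
  rw [hc, smul_zero]
  exact fun h => hA ((Finset.subset_insert j A).trans h)

omit [Fintype W] in
theorem sign_insert_insert {A : Finset W} {i j : W} (h : i < j) :
    sign R i (insert i (insert j A)) = sign R i (insert i A) := by
  unfold sign
  congr 2
  ext x
  simp only [Finset.mem_filter, Finset.mem_insert]
  constructor
  · rintro ⟨rfl | rfl | h1, h2⟩
    · exact absurd h2 (lt_irrefl _)
    · exact absurd h2 h.asymm
    · exact ⟨Or.inr h1, h2⟩
  · rintro ⟨rfl | h1, h2⟩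
    · exact absurd h2 (lt_irrefl _)
    · exact ⟨Or.inr (Or.inr h1), h2⟩

omit [Fintype W] in
theorem sign_singleton (i : W) : sign R i {i} = 1 := by
  simp [sign, Finset.filter_singleton]

/-- Contraction commutes with the restriction to the sets that contain a fixed largest element. -/
theorem contract_insert {c b : Finset W → M} {s : Finset W} {j : W} (hj : ∀ i ∈ s, i < j)
    (hc : ∀ A, ¬ A ⊆ insert j s → c A = 0) (hb : ∀ A, ¬ A ⊆ s → b A = 0)
    (h : ∀ A, A ⊆ s → c (insert j A) = b A) (A : Finset W) (hA : A ⊆ s) :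
    contract f c (insert j A) = contract f b A := by
  have hjs : j ∉ s := fun h => lt_irrefl _ (hj j h)
  have hjA : j ∉ A := fun h => hjs (hA h)
  rw [contract_apply, contract_apply, Finset.compl_insert]
  rw [← Finset.add_sum_erase Aᶜ _ (Finset.mem_compl.2 hjA),
    hb (insert j A) (fun h => hjs (h (Finset.mem_insert_self _ _))), smul_zero, zero_add]
  refine Finset.sum_congr rfl fun i hi => ?_
  rw [Finset.mem_erase, Finset.mem_compl] at hi
  by_cases his : i ∈ s
  · rw [sign_insert_insert (hj i his), Finset.insert_comm,
      h _ (Finset.insert_subset his hA)]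
  · rw [hc _ (fun h => ?_), hb _ (fun h => his (h (Finset.mem_insert_self _ _))),
      smul_zero, smul_zero]
    have := h (Finset.mem_insert_self i _)
    rw [Finset.mem_insert] at this
    exact this.elim hi.1 his

/-- The Koszul complex of a family that is regular on `M`, in every order, is acyclic. -/
theorem exists_contract_eq
    (hreg : ∀ (s : Finset W) (j : W), j ∉ s → ∀ (m : M) (g : W → M),
      f j • m = ∑ i ∈ s, f i • g i → ∃ g' : W → M, m = ∑ i ∈ s, f i • g' i) (s : Finset W) :
    ∀ (n : ℕ) (c : Finset W → M), (∀ A, A.card ≠ n + 1 → c A = 0) → (∀ A, ¬ A ⊆ s → c A = 0) →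
      contract f c = 0 → ∃ b : Finset W → M, (∀ A, A.card ≠ n + 2 → b A = 0) ∧
        (∀ A, ¬ A ⊆ s → b A = 0) ∧ contract f b = c := by
  induction s using Finset.induction_on_max with
  -- The only subset of `∅` has cardinality 0, so a chain of degree `n + 1` supported there
  -- vanishes.
  | empty =>
    intro n c hc hs _
    refine ⟨0, fun _ _ => rfl, fun _ _ => rfl, ?_⟩
    rw [map_zero]
    funext A
    by_cases h : A = ∅
    · subst h
      exact (hc ∅ (by simp)).symm
    · exact (hs A (fun h' => h (Finset.subset_empty.1 h'))).symm
  | insert j s hj ih =>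
    intro n c hc hs hcc
    have hjs : j ∉ s := fun h => lt_irrefl _ (hj j h)
    -- The part of `c` on sets containing `j`, with `j` removed. As `j` is largest, it is again a
    -- cycle, now of degree `n` and supported on subsets of `s`.
    let c₁ : Finset W → M := fun A => if A ⊆ s then c (insert j A) else 0
    have hc₁s : ∀ A, ¬ A ⊆ s → c₁ A = 0 := fun A hA => if_neg hA
    have hcc₁ : ∀ A, A ⊆ s → c (insert j A) = c₁ A := fun A hA => (if_pos hA).symm
    have hc₁n : ∀ A, A.card ≠ n → c₁ A = 0 := by
      intro A hA
      by_cases h : A ⊆ s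
      · rw [← hcc₁ A h, hc]
        rw [Finset.card_insert_of_notMem (fun h' => hjs (h h'))]
        omega
      · exact hc₁s A h
    have hc₁0 : contract f c₁ = 0 := by
      funext A
      by_cases h : A ⊆ s
      · rw [← contract_insert f hj hs hc₁s hcc₁ A h, hcc]
        rfl
      · exact contract_eq_zero_of_not_subset f hc₁s A h
    obtain ⟨b₁, hb₁n, hb₁s, hb₁⟩ : ∃ b : Finset W → M, (∀ A, A.card ≠ n + 1 → b A = 0) ∧
        (∀ A, ¬ A ⊆ s → b A = 0) ∧ contract f b = c₁ := by
      cases n with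
      | succ n => exact ih n c₁ hc₁n hc₁s hc₁0
      | zero =>
        have h0 : contract f c ∅ = 0 := congrFun hcc ∅
        have h1 : f j • c {j} = ∑ i ∈ s, f i • (- c {i}) := by
          rw [contract_apply, Finset.compl_empty,
            ← Finset.sum_subset (Finset.subset_univ (insert j s)),
            Finset.sum_insert hjs] at h0
          · simp only [insert_empty_eq, sign_singleton, one_mul] at h0
            rw [eq_neg_of_add_eq_zero_left h0]
            simp
          · intro i _ hi
            rw [hs, smul_zero]
            simpa using hi
        -- The only use of regularity: for a 1-cycle the equation at `∅` puts `f j • c {j}` in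
        -- `(f_s) M`, so `c {j}` itself lies there, and its coefficients form the bounding chain.
        obtain ⟨g, hg⟩ := hreg s j hjs _ _ h1
        have hb : ∀ i ∈ s, ∑ x ∈ s, (if ({i} : Finset W) = {x} then g x else 0) = g i := by
          intro i hi
          rw [Finset.sum_eq_single i]
          · simp
          · intro x _ hx
            rw [if_neg]
            simpa using hx.symm
          · exact fun h => absurd hi h
        have hbs : ∀ A, ¬ A ⊆ s → ∑ x ∈ s, (if A = {x} then g x else 0) = 0 := by
          intro A hA
          refine Finset.sum_eq_zero fun i hi => if_neg ?_
          rintro rfl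
          exact hA (Finset.singleton_subset_iff.2 hi)
        have hbn : ∀ A : Finset W, A.card ≠ 0 + 1 → ∑ x ∈ s, (if A = {x} then g x else 0) = 0 := by
          intro A hA
          refine Finset.sum_eq_zero fun i hi => if_neg ?_
          rintro rfl
          exact hA (by simp)
        refine ⟨fun A => ∑ i ∈ s, if A = {i} then g i else 0, hbn, hbs, ?_⟩
        funext A
        by_cases hA : A = ∅
        · subst hA
          rw [← hcc₁ ∅ (Finset.empty_subset s), insert_empty_eq, hg, contract_apply,
            Finset.compl_empty,
            ← Finset.sum_subset (Finset.subset_univ s)]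
          · refine Finset.sum_congr rfl fun i hi => ?_
            rw [insert_empty_eq, hb i hi, sign_singleton, one_mul]
          · intro i _ hi
            rw [hbs, smul_zero]
            simpa using hi
        · have : A.card ≠ 0 := by simpa using hA
          rw [hc₁n A this]
          exact contract_eq_zero_of_card f hbn A this
    -- Putting `j` back into the sets of `b₁` gives a chain whose boundary agrees with `c` on all
    -- sets containing `j`; the difference is a cycle on subsets of `s`, to which induction applies.
    let up : Finset W → M := fun B => if j ∈ B then b₁ (B.erase j) else 0
    have hup : ∀ A, A ⊆ s → up (insert j A) = b₁ A := fun A hA => by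
      simp only [up, Finset.mem_insert_self, if_true,
        Finset.erase_insert (fun h' => hjs (hA h'))]
    have hups : ∀ A, ¬ A ⊆ insert j s → up A = 0 := by
      intro A hA
      by_cases h : j ∈ A
      · simp only [up, if_pos h]
        refine hb₁s _ fun h' => hA ?_
        rw [← Finset.insert_erase h]
        exact Finset.insert_subset_insert j h'
      · exact if_neg h
    have hupn : ∀ A, A.card ≠ n + 1 + 1 → up A = 0 := by
      intro A hA
      by_cases h : j ∈ A
      · simp only [up, if_pos h]
        refine hb₁n _ ?_
        have := Finset.card_erase_add_one h
        omega
      · exact if_neg h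
    obtain ⟨b₀, hb₀n, hb₀s, hb₀⟩ := ih n (c - contract f up) (by
        intro A hA
        rw [Pi.sub_apply, hc A hA, contract_eq_zero_of_card f hupn A hA, sub_zero]) (by
        intro A hA
        rw [Pi.sub_apply]
        by_cases h : A ⊆ insert j s
        · have hjA : j ∈ A := by
            by_contra hjA
            exact hA ((Finset.subset_insert_iff_of_notMem hjA).1 h)
          have h2 : A.erase j ⊆ s := Finset.subset_insert_iff.1 h
          rw [← Finset.insert_erase hjA, contract_insert f hj hups hb₁s hup _ h2, hb₁,
            hcc₁ _ h2, sub_self]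
        · rw [hs A h, contract_eq_zero_of_not_subset f hups A h, sub_zero]) (by
        rw [map_sub, hcc, contract_contract, sub_zero])
    refine ⟨b₀ + up, fun A hA => ?_, fun A hA => ?_, ?_⟩
    · rw [Pi.add_apply, hb₀n A hA, hupn A hA, add_zero]
    · rw [Pi.add_apply, hups A hA, hb₀s A fun h => hA (h.trans (Finset.subset_insert j s)),
        add_zero]
    · rw [map_add, hb₀, sub_add_cancel]

end Contract

/-! ### Exactness of the total complex by a zigzag -/

section Total

variable {R W : Type*} [CommRing R] [LinearOrder W] [Fintype W] (f : W → R)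
  {G : ℕ → Type*} [∀ i, AddCommGroup (G i)] [∀ i, Module R (G i)]
  (d : ∀ i, G (i + 1) →ₗ[R] G i)

/-- The differential of the tensor product of a complex `G` with the Koszul complex of `f`, on
families of elements of `G` indexed by the subsets of `W`. -/
def totalDifferential : (∀ i, Finset W → G i) →ₗ[R] (∀ i, Finset W → G i) where
  toFun c i A := d i (c (i + 1) A) + (-1 : R) ^ i • contract f (c i) A
  map_add' x y := by
    funext i A
    simp only [Pi.add_apply, map_add, smul_add]
    abel
  map_smul' r x := by
    funext i A
    simp only [Pi.smul_apply, map_smul, RingHom.id_apply, smul_add, smul_comm r]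

theorem totalDifferential_apply (c : ∀ i, Finset W → G i) (i : ℕ) (A : Finset W) :
    totalDifferential f d c i A = d i (c (i + 1) A) + (-1 : R) ^ i • contract f (c i) A := rfl

theorem totalDifferential_totalDifferential (hd : ∀ i x, d i (d (i + 1) x) = 0)
    (c : ∀ i, Finset W → G i) : totalDifferential f d (totalDifferential f d c) = 0 := by
  funext i A
  have h1 : contract f (totalDifferential f d c i) =
      contract f (fun A => d i (c (i + 1) A)) := by
    have : totalDifferential f d c i =
      (fun A => d i (c (i + 1) A)) + (-1 : R) ^ i • contract f (c i) := rfl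
    rw [this, map_add, map_smul, contract_contract, smul_zero, add_zero]
  rw [totalDifferential_apply, h1, totalDifferential_apply, map_add, hd, zero_add, map_smul,
    map_contract, ← add_smul, pow_succ]
  simp

/-- The family `c` is homogeneous of total degree `n`. -/
def IsHomogeneousFamily (n : ℕ) (c : ∀ i, Finset W → G i) : Prop :=
  ∀ i A, i + A.card ≠ n → c i A = 0

variable {f d} in
theorem IsHomogeneousFamily.totalDifferential {n : ℕ} {c : ∀ i, Finset W → G i}
    (hc : IsHomogeneousFamily (n + 1) c) : IsHomogeneousFamily n (totalDifferential f d c) := by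
  intro i A h
  rw [totalDifferential_apply, hc (i + 1) A (by omega), map_zero, zero_add]
  have : contract f (c i) A = 0 := by
    refine Finset.sum_eq_zero fun j hj => ?_
    rw [hc, smul_zero]
    rw [Finset.card_insert_of_notMem (Finset.mem_compl.1 hj)]
    omega
  rw [this, smul_zero]

omit [LinearOrder W] [Fintype W] in
theorem IsHomogeneousFamily.single {n i : ℕ} {y : Finset W → G i}
    (hy : ∀ A, i + A.card ≠ n → y A = 0) :
    IsHomogeneousFamily n (Pi.single i y : ∀ i, Finset W → G i) := by
  intro i' A h
  by_cases hi : i' = i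
  · subst hi
    rw [Pi.single_eq_same, hy A h]
  · rw [Pi.single_eq_of_ne hi, Pi.zero_apply]

omit [LinearOrder W] [Fintype W] in
theorem IsHomogeneousFamily.add {n : ℕ} {c c' : ∀ i, Finset W → G i}
    (hc : IsHomogeneousFamily n c) (hc' : IsHomogeneousFamily n c') :
    IsHomogeneousFamily n (c + c') := fun i A h => by
  rw [Pi.add_apply, Pi.add_apply, hc i A h, hc' i A h, add_zero]

omit [LinearOrder W] [Fintype W] in
theorem IsHomogeneousFamily.sub {n : ℕ} {c c' : ∀ i, Finset W → G i}
    (hc : IsHomogeneousFamily n c) (hc' : IsHomogeneousFamily n c') :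
    IsHomogeneousFamily n (c - c') := fun i A h => by
  rw [Pi.sub_apply, Pi.sub_apply, hc i A h, hc' i A h, sub_zero]

theorem totalDifferential_single_self (i : ℕ) (y : Finset W → G (i + 1)) (A : Finset W) :
    totalDifferential f d (Pi.single (i + 1) y) i A = d i (y A) := by
  rw [totalDifferential_apply, Pi.single_eq_same, Pi.single_eq_of_ne (by omega), map_zero,
    Pi.zero_apply, smul_zero, add_zero]

theorem totalDifferential_single_of_lt (i i' : ℕ) (h : i' < i) (y : Finset W → G (i + 1)) :
    totalDifferential f d (Pi.single (i + 1) y) i' = 0 := by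
  funext A
  rw [totalDifferential_apply, Pi.single_eq_of_ne (by omega), Pi.single_eq_of_ne (by omega),
    map_zero, Pi.zero_apply, map_zero, Pi.zero_apply, smul_zero, add_zero]

variable {f d}

/-- A cycle that vanishes at `0, …, p - 1` and is a pointwise boundary at `p` is a boundary. -/
theorem exists_totalDifferential_eq_of_lt (hd : ∀ i x, d i (d (i + 1) x) = 0)
    (hex : ∀ i x, d i x = 0 → ∃ y, d (i + 1) y = x) (n k : ℕ) :
    ∀ (p : ℕ), p + k = n + 1 → ∀ c : ∀ i, Finset W → G i, IsHomogeneousFamily n c →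
      totalDifferential f d c = 0 → (∀ i < p, c i = 0) → (∀ A, ∃ y, d p y = c p A) →
      ∃ b, IsHomogeneousFamily (n + 1) b ∧ totalDifferential f d b = c := by
  classical
  induction k with
  | zero =>
    -- Here `p = n + 1`, and indices `i ≥ p` exceed the total degree, so `c` is zero.
    intro p hp c hc _ h0 _
    refine ⟨0, fun _ _ _ => rfl, ?_⟩
    rw [map_zero]
    funext i A
    by_cases h : i < p
    · rw [h0 i h]
      rfl
    · exact (hc i A (by omega)).symm
  | succ k ih =>
    intro p hp c hc hD h0 hy
    choose y hy using hy
    -- The chosen preimages are cut off outside the right cardinality so that the correction is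
    -- homogeneous.
    let y' : Finset W → G (p + 1) := fun A => if p + A.card = n then y A else 0
    have hy' : ∀ A, d p (y' A) = c p A := fun A => by
      by_cases h : p + A.card = n
      · simp only [y', if_pos h, hy]
      · simp only [y', if_neg h, map_zero, hc p A h]
    have hb : IsHomogeneousFamily (n + 1) (Pi.single (p + 1) y' : ∀ i, Finset W → G i) :=
      IsHomogeneousFamily.single fun A h => if_neg (by omega)
    have hz : ∀ i < p + 1, (c - totalDifferential f d (Pi.single (p + 1) y')) i = 0 := by
      intro i hi
      funext A
      rcases Nat.lt_succ_iff_lt_or_eq.1 hi with h | rfl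
      · rw [Pi.sub_apply, totalDifferential_single_of_lt f d p i h, h0 i h, sub_zero]
      · rw [Pi.sub_apply, Pi.sub_apply, totalDifferential_single_self, hy', sub_self]
        rfl
    have hD' : totalDifferential f d (c - totalDifferential f d (Pi.single (p + 1) y')) = 0 := by
      rw [map_sub, hD, totalDifferential_totalDifferential f d hd, sub_zero]
    obtain ⟨b, hbn, hb'⟩ := ih (p + 1) (by omega) _ (hc.sub hb.totalDifferential) hD' hz
      (fun A => hex p _ (by
        have := congrFun (congrFun hD' p) A
        rw [totalDifferential_apply, hz p (by omega), map_zero, Pi.zero_apply, smul_zero,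
          add_zero] at this
        exact this))
    refine ⟨b + Pi.single (p + 1) y', hbn.add hb, ?_⟩
    rw [map_add, hb', sub_add_cancel]

variable {M : Type*} [AddCommGroup M] [Module R M] (ε : G 0 →ₗ[R] M)

/-- The augmentation turns row 0 of a cycle into a Koszul cycle over `M`. Lifting a bounding chain
along `ε` and subtracting its boundary leaves row 0 in `ker ε`, the image of `d 0`, where the
row-by-row zigzag can start. -/
theorem exists_totalDifferential_eq (hε : Function.Surjective ε)
    (hd : ∀ i x, d i (d (i + 1) x) = 0) (hd0 : ∀ x, ε (d 0 x) = 0)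
    (hex : ∀ i x, d i x = 0 → ∃ y, d (i + 1) y = x) (hex0 : ∀ x, ε x = 0 → ∃ y, d 0 y = x)
    (hreg : ∀ (s : Finset W) (j : W), j ∉ s → ∀ (m : M) (g : W → M),
      f j • m = ∑ i ∈ s, f i • g i → ∃ g' : W → M, m = ∑ i ∈ s, f i • g' i)
    (n : ℕ) (c : ∀ i, Finset W → G i) (hc : IsHomogeneousFamily (n + 1) c)
    (hD : totalDifferential f d c = 0) :
    ∃ b, IsHomogeneousFamily (n + 2) b ∧ totalDifferential f d b = c := by
  classical
  have h0 : contract f (fun A => ε (c 0 A)) = 0 := by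
    funext A
    have := congrArg ε (congrFun (congrFun hD 0) A)
    rwa [totalDifferential_apply, map_add, hd0, zero_add, pow_zero, one_smul, map_contract,
      Pi.zero_apply, Pi.zero_apply, map_zero] at this
  obtain ⟨m, hmn, -, hm⟩ := exists_contract_eq f hreg Finset.univ n (fun A => ε (c 0 A))
    (fun A hA => by rw [hc 0 A (by omega), map_zero])
    (fun A hA => absurd (Finset.subset_univ A) hA) h0
  let y : Finset W → G 0 := fun A => if A.card = n + 2 then (hε (m A)).choose else 0
  have hy : ∀ A, ε (y A) = m A := fun A => by
    by_cases h : A.card = n + 2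
    · simp only [y, if_pos h]
      exact (hε (m A)).choose_spec
    · simp only [y, if_neg h, map_zero, hmn A h]
  have hb : IsHomogeneousFamily (n + 2) (Pi.single 0 y : ∀ i, Finset W → G i) :=
    IsHomogeneousFamily.single fun A h => if_neg (by omega)
  obtain ⟨b, hbn, hb'⟩ := exists_totalDifferential_eq_of_lt hd hex (n + 1) (n + 2) 0 (by omega)
    (c - totalDifferential f d (Pi.single 0 y)) (hc.sub hb.totalDifferential)
    (by rw [map_sub, hD, totalDifferential_totalDifferential f d hd, sub_zero])
    (fun i hi => absurd hi (by omega)) (fun A => hex0 _ (by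
      rw [Pi.sub_apply, Pi.sub_apply, totalDifferential_apply, Pi.single_eq_same,
        Pi.single_eq_of_ne (by omega), Pi.zero_apply, map_zero, zero_add, pow_zero, one_smul,
        map_sub, map_contract, sub_eq_zero]
      simp only [hy]
      exact (congrFun hm A).symm))
  refine ⟨b + Pi.single 0 y, hbn.add hb, ?_⟩
  rw [map_add, hb', sub_add_cancel]

/-- The bottom degree: the kernel of `G 0 → M ⧸ (f) M` consists of boundaries. Lifts of the `g i`
account for the Koszul part, and the remainder lies in `ker ε`. -/
theorem exists_totalDifferential_eq_zero (hε : Function.Surjective ε)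
    (hex0 : ∀ x, ε x = 0 → ∃ y, d 0 y = x) (x : G 0) (g : W → M) (hx : ε x = ∑ i, f i • g i) :
    ∃ b : ∀ i, Finset W → G i, IsHomogeneousFamily 1 b ∧ totalDifferential f d b 0 ∅ = x := by
  classical
  choose g' hg' using fun i => hε (g i)
  let y : Finset W → G 0 := fun A => ∑ i, if A = {i} then g' i else 0
  have hy : contract f y ∅ = ∑ i, f i • g' i := by
    rw [contract_apply, Finset.compl_empty]
    refine Finset.sum_congr rfl fun i _ => ?_
    rw [insert_empty_eq, sign_singleton, one_mul]
    congr 1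
    simp only [y, Finset.singleton_inj]
    rw [Finset.sum_ite_eq, if_pos (Finset.mem_univ _)]
  obtain ⟨z, hz⟩ := hex0 (x - ∑ i, f i • g' i) (by simp [hx, hg'])
  refine ⟨Pi.single 0 y + Pi.single 1 (Pi.single ∅ z), IsHomogeneousFamily.add ?_ ?_, ?_⟩
  · refine IsHomogeneousFamily.single fun A h => Finset.sum_eq_zero fun i _ => if_neg ?_
    rintro rfl
    exact h (by simp)
  · refine IsHomogeneousFamily.single fun A h => Pi.single_eq_of_ne ?_ _
    rintro rfl
    exact h (by simp)
  · rw [map_add, Pi.add_apply, Pi.add_apply, totalDifferential_single_self, totalDifferential_apply,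
      Pi.single_eq_same, Pi.single_eq_same, Pi.single_eq_of_ne (by omega), Pi.zero_apply, map_zero,
      zero_add, pow_zero, one_smul, hz, hy, add_sub_cancel]

end Total

end Koszul

namespace Koszul

/-! ### The total differential on families with one nonzero entry -/

section Single

variable {R W : Type*} [CommRing R] [LinearOrder W] [Fintype W] (f : W → R)

theorem contract_single {M : Type*} [AddCommGroup M] [Module R M] (A : Finset W) (g : M) :
    contract f (Pi.single A g) =
      ∑ j ∈ A, Pi.single (A.erase j) ((sign R j A * f j) • g) := by
  funext B
  -- Both sums reduce to indices in `A` but not in `B`; the other terms vanish.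
  rw [contract_apply, Finset.sum_apply, ← Finset.sum_filter_add_sum_filter_not A (· ∈ B),
    ← Finset.sum_filter_add_sum_filter_not Bᶜ (· ∈ A)]
  have h1 : ∑ j ∈ A with j ∈ B, (Pi.single (A.erase j) ((sign R j A * f j) • g) : _ → M) B = 0 := by
    refine Finset.sum_eq_zero fun j hj => Pi.single_eq_of_ne ?_ _
    rintro rfl
    exact Finset.notMem_erase j A (Finset.mem_filter.1 hj).2
  have h2 : ∑ j ∈ Bᶜ with j ∉ A, (sign R j (insert j B) * f j) •
      (Pi.single A g : _ → M) (insert j B) = 0 := by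
    refine Finset.sum_eq_zero fun j hj => ?_
    rw [Pi.single_eq_of_ne, smul_zero]
    rintro rfl
    exact (Finset.mem_filter.1 hj).2 (Finset.mem_insert_self j B)
  rw [h1, h2, add_zero, zero_add]
  refine Finset.sum_congr ?_ fun j hj => ?_
  · ext j
    simp [and_comm]
  · rw [Finset.mem_filter] at hj
    by_cases h : insert j B = A
    · subst h
      rw [Finset.erase_insert hj.2, Pi.single_eq_same, Pi.single_eq_same]
    · rw [Pi.single_eq_of_ne h, smul_zero, Pi.single_eq_of_ne]
      rintro rfl
      exact h (Finset.insert_erase hj.1)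

variable {G : ℕ → Type*} [∀ i, AddCommGroup (G i)] [∀ i, Module R (G i)]
  (d : ∀ i, G (i + 1) →ₗ[R] G i)

theorem totalDifferential_single_zero (y : Finset W → G 0) :
    totalDifferential f d (Pi.single 0 y) = Pi.single 0 (contract f y) := by
  funext i A
  rw [totalDifferential_apply, Pi.single_eq_of_ne (by omega), Pi.zero_apply, map_zero, zero_add]
  cases i with
  | zero => rw [Pi.single_eq_same, Pi.single_eq_same, pow_zero, one_smul]
  | succ i =>
    rw [Pi.single_eq_of_ne (by omega), Pi.single_eq_of_ne (by omega), map_zero, Pi.zero_apply,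
      smul_zero]

theorem totalDifferential_single_succ (i : ℕ) (y : Finset W → G (i + 1)) :
    totalDifferential f d (Pi.single (i + 1) y) =
      Pi.single i (fun A => d i (y A)) +
        Pi.single (i + 1) ((-1 : R) ^ (i + 1) • contract f y) := by
  funext i' A
  rw [Pi.add_apply, Pi.add_apply]
  by_cases h : i' = i
  · subst h
    rw [totalDifferential_single_self, Pi.single_eq_same, Pi.single_eq_of_ne (by omega),
      Pi.zero_apply, add_zero]
  · rw [totalDifferential_apply, Pi.single_eq_of_ne (by omega), Pi.single_eq_of_ne h,
      Pi.zero_apply, Pi.zero_apply, map_zero, zero_add, zero_add]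
    by_cases h' : i' = i + 1
    · subst h'
      rw [Pi.single_eq_same, Pi.single_eq_same, Pi.smul_apply]
    · rw [Pi.single_eq_of_ne h', Pi.single_eq_of_ne h', map_zero, Pi.zero_apply, smul_zero]

end Single

/-! ### The categorical tensor product described by families -/

section Tensor

variable {R : Type u} {W : Type} [CommRing R] [LinearOrder W] (f : W → R)
  (G : ChainComplex (ModuleCat.{u} R) ℕ)

/-- The coefficients in `N` of an element of `N ⊗ Chains R W j`. -/
noncomputable def coefficients (N : Type*) [AddCommGroup N] [Module R N] (j : ℕ) :
    TensorProduct R N (Chains R W j) →ₗ[R] (Finset W → N) :=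
  LinearMap.pi fun A => if h : A.card = j then
    TensorProduct.lift ((LinearMap.lsmul R N).flip.compr₂
      LinearMap.id |>.compl₂ (Finsupp.lapply ⟨A, h⟩)) else 0

omit [LinearOrder W] in
theorem coefficients_tmul_single [DecidableEq W] (N : Type*) [AddCommGroup N] [Module R N]
    (A : Finset W) (g : N) :
    coefficients N A.card (g ⊗ₜ[R] (Finsupp.single ⟨A, rfl⟩ 1)) = Pi.single A g := by
  funext B
  rw [coefficients, LinearMap.pi_apply]
  by_cases hB : B = A
  · subst hB
    simp
  · rw [Pi.single_eq_of_ne hB]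
    by_cases h : B.card = A.card
    · rw [dif_pos h]
      have : (Finsupp.single ⟨A, rfl⟩ 1 : Chains R W A.card) ⟨B, h⟩ = 0 :=
        Finsupp.single_eq_of_ne fun h' => hB (congrArg Subtype.val h')
      simp [this]
    · rw [dif_neg h, LinearMap.zero_apply]

/-- The inclusion of a summand of the tensor product with the Koszul complex. -/
noncomputable def summand (n i j : ℕ) (h : i + j = n) :
    TensorProduct R (G.X i) (Chains R W j) →ₗ[R] (G ⊗ complex f).X n :=
  (HomologicalComplex.ιTensorObj G (complex f) i j n h).hom

variable {G} in
theorem hom_ext_summand {n : ℕ} {M : Type u} [AddCommGroup M] [Module R M]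
    {φ ψ : (G ⊗ complex f).X n →ₗ[R] M}
    (h : ∀ i j hij, φ ∘ₗ summand f G n i j hij = ψ ∘ₗ summand f G n i j hij) : φ = ψ := by
  have : ModuleCat.ofHom (Y := ModuleCat.of R M) φ = ModuleCat.ofHom ψ :=
    HomologicalComplex.mapBifunctor.hom_ext fun i j hij => ModuleCat.hom_ext (h i j hij)
  exact congrArg ModuleCat.Hom.hom this

/-- The linear map on the tensor product with the Koszul complex that is given by its values on
the summands. -/
noncomputable def desc {n : ℕ} {M : Type u} [AddCommGroup M] [Module R M]
    (φ : ∀ i j, TensorProduct R (G.X i) (Chains R W j) →ₗ[R] M) :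
    (G ⊗ complex f).X n →ₗ[R] M :=
  (HomologicalComplex.mapBifunctorDesc (K₁ := G) (K₂ := complex f) (F := curriedTensor _)
    (A := ModuleCat.of R M) (fun i j _ => ModuleCat.ofHom (φ i j))).hom

theorem desc_summand {n : ℕ} {M : Type u} [AddCommGroup M] [Module R M]
    (φ : ∀ i j, TensorProduct R (G.X i) (Chains R W j) →ₗ[R] M) (i j : ℕ) (h : i + j = n)
    (x : TensorProduct R (G.X i) (Chains R W j)) :
    desc f G φ (summand f G n i j h x) = φ i j x := by
  have := HomologicalComplex.ι_mapBifunctorDesc (K₁ := G) (K₂ := complex f)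
    (c := ComplexShape.down ℕ) (F := curriedTensor _)
    (A := ModuleCat.of R M) (fun i j _ => ModuleCat.ofHom (φ i j)) i j h
  exact LinearMap.congr_fun (congrArg ModuleCat.Hom.hom this) x

/-- The inclusion of `G_i ⊗ e_A` in degree `n` of the tensor product with the Koszul
complex; it is zero if the degrees do not match. -/
noncomputable def inclusion (n i : ℕ) (A : Finset W) : G.X i →ₗ[R] (G ⊗ complex f).X n :=
  if h : i + A.card = n then
    summand f G n i A.card h ∘ₗ
      (TensorProduct.mk R (G.X i) (Chains R W A.card)).flip (Finsupp.single ⟨A, rfl⟩ 1)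
  else 0

theorem summand_tmul_single (n i j : ℕ) (h : i + j = n) (A : {A : Finset W // A.card = j})
    (g : G.X i) (r : R) :
    summand f G n i j h (g ⊗ₜ[R] (Finsupp.single A r)) = r • inclusion f G n i A g := by
  obtain ⟨A, rfl⟩ := A
  rw [inclusion, dif_pos h, ← mul_one r, ← smul_eq_mul, ← Finsupp.smul_single,
    TensorProduct.tmul_smul, map_smul, smul_eq_mul, mul_one]
  rfl

theorem inclusion_apply (n i : ℕ) (A : Finset W) (h : i + A.card = n) (g : G.X i) :
    inclusion f G n i A g = summand f G n i A.card h (g ⊗ₜ[R] (Finsupp.single ⟨A, rfl⟩ 1)) := by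
  rw [summand_tmul_single, one_smul]

theorem inclusion_of_ne (n i : ℕ) (A : Finset W) (h : i + A.card ≠ n) :
    inclusion f G n i A = 0 := dif_neg h

variable {G} in
theorem hom_ext_inclusion {n : ℕ} {M : Type u} [AddCommGroup M] [Module R M]
    {φ ψ : (G ⊗ complex f).X n →ₗ[R] M}
    (h : ∀ i A, i + A.card = n → φ ∘ₗ inclusion f G n i A = ψ ∘ₗ inclusion f G n i A) : φ = ψ := by
  refine hom_ext_summand f fun i j hij => TensorProduct.ext' fun g x => ?_
  induction x using Finsupp.induction_linear with
  | zero => rw [TensorProduct.tmul_zero, map_zero, map_zero]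
  | add x y hx hy => rw [TensorProduct.tmul_add, map_add, map_add, hx, hy]
  | single A r =>
    rw [LinearMap.comp_apply, LinearMap.comp_apply, summand_tmul_single, map_smul, map_smul]
    exact congrArg (r • ·) (LinearMap.congr_fun (h i A (by rw [A.2, hij])) g)

/-- The components of an element of the tensor product with the Koszul complex. -/
noncomputable def components (n : ℕ) :
    (G ⊗ complex f).X n →ₗ[R] (∀ i, Finset W → G.X i) :=
  desc f G fun i j => LinearMap.single R (fun i => Finset W → G.X i) i ∘ₗ coefficients (G.X i) j

theorem components_inclusion (n i : ℕ) (A : Finset W) (h : i + A.card = n) (g : G.X i) :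
    components f G n (inclusion f G n i A g) = Pi.single i (Pi.single A g) := by
  rw [inclusion_apply f G n i A h, components, desc_summand, LinearMap.comp_apply,
    coefficients_tmul_single]
  rfl

theorem isHomogeneousFamily_components (n : ℕ) (z : (G ⊗ complex f).X n) :
    IsHomogeneousFamily n (components f G n z) := by
  intro i A h
  have : LinearMap.proj (R := R) (φ := fun _ : Finset W => G.X i) A ∘ₗ
      LinearMap.proj (R := R) (φ := fun i => Finset W → G.X i) i ∘ₗ components f G n = 0 := by
    refine hom_ext_inclusion f fun i' A' h' => LinearMap.ext fun g => ?_
    simp only [LinearMap.comp_apply, components_inclusion f G n i' A' h', LinearMap.proj_apply,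
      LinearMap.zero_apply]
    by_cases hi : i = i'
    · subst hi
      rw [Pi.single_eq_same, Pi.single_eq_of_ne]
      rintro rfl
      exact h h'
    · rw [Pi.single_eq_of_ne hi, Pi.zero_apply]
  exact LinearMap.congr_fun this z

theorem d_summand (n i j : ℕ) (h : i + j = n + 1)
    (x : TensorProduct R (G.X i) (Chains R W j)) :
    ((G ⊗ complex f).d (n + 1) n).hom (summand f G (n + 1) i j h x) =
      (HomologicalComplex.mapBifunctor.d₁ G (complex f) (curriedTensor _)
        (ComplexShape.down ℕ) i j n).hom x +
      (HomologicalComplex.mapBifunctor.d₂ G (complex f) (curriedTensor _)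
        (ComplexShape.down ℕ) i j n).hom x := by
  have h1 := HomologicalComplex.mapBifunctor.ι_D₁ G (complex f) (curriedTensor _)
    (ComplexShape.down ℕ) (n + 1) n i j h
  have h2 := HomologicalComplex.mapBifunctor.ι_D₂ G (complex f) (curriedTensor _)
    (ComplexShape.down ℕ) (n + 1) n i j h
  rw [← h1, ← h2]
  rfl

theorem d₁_succ (n i j : ℕ) (h : i + j = n) (g : G.X (i + 1)) (x : Chains R W j) :
    (HomologicalComplex.mapBifunctor.d₁ G (complex f) (curriedTensor _)
        (ComplexShape.down ℕ) (i + 1) j n).hom (g ⊗ₜ[R] x) =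
      summand f G n i j h ((G.d (i + 1) i).hom g ⊗ₜ[R] x) := by
  have h1 := HomologicalComplex.mapBifunctor.d₁_eq G (complex f) (curriedTensor _)
    (ComplexShape.down ℕ) (i₁ := i + 1) (i₁' := i) rfl j n h
  have h2 : ComplexShape.ε₁ (ComplexShape.down ℕ) (ComplexShape.down ℕ) (ComplexShape.down ℕ)
    (i + 1, j) = 1 := rfl
  rw [h1, h2, one_smul]
  rfl

theorem d₁_zero (n j : ℕ) :
    HomologicalComplex.mapBifunctor.d₁ G (complex f) (curriedTensor _)
        (ComplexShape.down ℕ) 0 j n = 0 :=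
  HomologicalComplex.mapBifunctor.d₁_eq_zero _ _ _ _ _ _ _ (by simp)

theorem d₂_zero (n i : ℕ) :
    HomologicalComplex.mapBifunctor.d₂ G (complex f) (curriedTensor _)
        (ComplexShape.down ℕ) i 0 n = 0 :=
  HomologicalComplex.mapBifunctor.d₂_eq_zero _ _ _ _ _ _ _ (by simp)

theorem d₂_succ (n i j : ℕ) (h : i + j = n) (g : G.X i) (x : Chains R W (j + 1)) :
    (HomologicalComplex.mapBifunctor.d₂ G (complex f) (curriedTensor _)
        (ComplexShape.down ℕ) i (j + 1) n).hom (g ⊗ₜ[R] x) =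
      (-1 : R) ^ i • summand f G n i j h (g ⊗ₜ[R] differential f j x) := by
  have h1 := HomologicalComplex.mapBifunctor.d₂_eq G (complex f) (curriedTensor _)
    (ComplexShape.down ℕ) i (i₂ := j + 1) (i₂' := j) rfl n h
  have h2 : (complex f).d (j + 1) j = ModuleCat.ofHom (differential f j) :=
    ChainComplex.of_d (fun n => ModuleCat.of R (Chains R W n))
      (fun n => ModuleCat.ofHom (differential f n)) j
  have h3 : ComplexShape.ε₂ (ComplexShape.down ℕ) (ComplexShape.down ℕ) (ComplexShape.down ℕ)
    (i, j + 1) = (-1) ^ i := rfl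
  rw [h1, h2, h3]
  -- The sign in the total complex is an integer unit, the one in the statement a power in `R`; they
  -- are compared by parity.
  rcases Nat.even_or_odd i with hi | hi
  · rw [hi.neg_one_pow, hi.neg_one_pow, one_smul, one_smul]
    rfl
  · rw [hi.neg_one_pow, hi.neg_one_pow, Units.neg_smul, one_smul, neg_smul, one_smul]
    rfl

theorem d₂_single (n i j : ℕ) (h : i + j = n + 1) (A : {A : Finset W // A.card = j}) (g : G.X i) :
    (HomologicalComplex.mapBifunctor.d₂ G (complex f) (curriedTensor _)
        (ComplexShape.down ℕ) i j n).hom (g ⊗ₜ[R] (Finsupp.single A 1 : Chains R W j)) =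
      (-1 : R) ^ i • ∑ a ∈ A.1, (sign R a A.1 * f a) • inclusion f G n i (A.1.erase a) g := by
  cases j with
  | zero =>
    have : A.1 = ∅ := Finset.card_eq_zero.1 A.2
    rw [this, Finset.sum_empty, smul_zero, d₂_zero]
    rfl
  | succ j =>
    rw [d₂_succ f G n i j (by omega), differential, Finsupp.linearCombination_single, one_smul,
      TensorProduct.tmul_sum, map_sum]
    congr 1
    simp only [summand_tmul_single]
    exact Finset.sum_attach A.1 fun a => (sign R a A.1 * f a) • inclusion f G n i (A.1.erase a) g

theorem d_inclusion_zero (n : ℕ) (A : Finset W) (h : 0 + A.card = n + 1) (g : G.X 0) :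
    ((G ⊗ complex f).d (n + 1) n).hom (inclusion f G (n + 1) 0 A g) =
      ∑ a ∈ A, (sign R a A * f a) • inclusion f G n 0 (A.erase a) g := by
  rw [inclusion_apply f G _ 0 A h, d_summand]
  refine (congrArg₂ (· + ·) ?_ (d₂_single f G n 0 _ h ⟨A, rfl⟩ g)).trans (zero_add _) |>.trans ?_
  · rw [d₁_zero]
    rfl
  · rw [pow_zero, one_smul]

theorem d_inclusion_succ (n i : ℕ) (A : Finset W) (h : i + 1 + A.card = n + 1) (g : G.X (i + 1)) :
    ((G ⊗ complex f).d (n + 1) n).hom (inclusion f G (n + 1) (i + 1) A g) =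
      inclusion f G n i A ((G.d (i + 1) i).hom g) + (-1 : R) ^ (i + 1) •
        ∑ a ∈ A, (sign R a A * f a) • inclusion f G n (i + 1) (A.erase a) g := by
  rw [inclusion_apply f G _ (i + 1) A h, d_summand, inclusion_apply f G n i A (by omega)]
  exact congrArg₂ (· + ·) (d₁_succ f G n i _ (by omega) g _)
    (d₂_single f G n (i + 1) _ h ⟨A, rfl⟩ g)

/-- The differential of `G` as a family of linear maps. -/
abbrev differentials (i : ℕ) : G.X (i + 1) →ₗ[R] G.X i := (G.d (i + 1) i).hom

variable [Fintype W]

theorem components_sum_erase (n i : ℕ) (A : Finset W) (h : i + A.card = n + 1) (g : G.X i) :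
    components f G n (∑ a ∈ A, (sign R a A * f a) • inclusion f G n i (A.erase a) g) =
      Pi.single i (contract f (Pi.single A g)) := by
  rw [map_sum, contract_single]
  have : ∀ a ∈ A, components f G n ((sign R a A * f a) • inclusion f G n i (A.erase a) g) =
      LinearMap.single R (fun i => Finset W → G.X i) i
        (Pi.single (A.erase a) ((sign R a A * f a) • g)) := by
    intro a ha
    have := Finset.card_erase_add_one ha
    rw [← map_smul, components_inclusion f G n i _ (by omega)]
    rfl
  rw [Finset.sum_congr rfl this, ← map_sum]
  rfl

/-- Together with injectivity of `components` and its surjectivity onto homogeneous families, this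
reduces exactness of the tensor product to exactness for families. -/
theorem components_d (n : ℕ) (z : (G ⊗ complex f).X (n + 1)) :
    components f G n (((G ⊗ complex f).d (n + 1) n).hom z) =
      totalDifferential f (differentials G) (components f G (n + 1) z) := by
  suffices h : components f G n ∘ₗ ((G ⊗ complex f).d (n + 1) n).hom =
      totalDifferential f (differentials G) ∘ₗ components f G (n + 1) from LinearMap.congr_fun h z
  refine hom_ext_inclusion f fun i A h => LinearMap.ext fun g => ?_
  simp only [LinearMap.comp_apply]
  rw [components_inclusion f G _ i A h]
  cases i with
  | zero =>
    rw [d_inclusion_zero f G n A h, components_sum_erase f G n 0 A h,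
      totalDifferential_single_zero]
  | succ i =>
    rw [d_inclusion_succ f G n i A h, map_add, map_smul, components_sum_erase f G n _ A h,
      totalDifferential_single_succ, components_inclusion f G n i A (by omega)]
    congr 1
    · congr 1
      funext B
      by_cases hB : B = A
      · subst hB
        rw [Pi.single_eq_same, Pi.single_eq_same]
      · rw [Pi.single_eq_of_ne hB, Pi.single_eq_of_ne hB, map_zero]
    · rw [← Pi.single_smul]

theorem sum_inclusion_components (n : ℕ) (z : (G ⊗ complex f).X n) :
    ∑ i ∈ Finset.range (n + 1), ∑ A : Finset W,
      inclusion f G n i A (components f G n z i A) = z := by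
  suffices h : ∑ i ∈ Finset.range (n + 1), ∑ A : Finset W, inclusion f G n i A ∘ₗ
      LinearMap.proj (R := R) (φ := fun _ : Finset W => G.X i) A ∘ₗ
      LinearMap.proj (R := R) (φ := fun i => Finset W → G.X i) i ∘ₗ components f G n =
      LinearMap.id by
    have := LinearMap.congr_fun h z
    simp only [LinearMap.sum_apply] at this
    exact this
  refine hom_ext_inclusion f fun i A h => LinearMap.ext fun g => ?_
  simp only [LinearMap.comp_apply, LinearMap.sum_apply, components_inclusion f G n i A h,
    LinearMap.proj_apply, LinearMap.id_apply]
  rw [Finset.sum_eq_single i, Finset.sum_eq_single A]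
  · rw [Pi.single_eq_same, Pi.single_eq_same]
  · intro B _ hB
    rw [Pi.single_eq_same, Pi.single_eq_of_ne hB, map_zero]
  · exact fun h => absurd (Finset.mem_univ _) h
  · intro i' _ hi
    refine Finset.sum_eq_zero fun B _ => ?_
    rw [Pi.single_eq_of_ne hi, Pi.zero_apply, map_zero]
  · intro h'
    rw [Finset.mem_range] at h'
    omega

theorem components_injective (n : ℕ) : Function.Injective (components f G n) := by
  intro x y h
  rw [← sum_inclusion_components f G n x, h, sum_inclusion_components]

theorem exists_components_eq (n : ℕ) (c : ∀ i, Finset W → G.X i) (hc : IsHomogeneousFamily n c) :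
    ∃ z, components f G n z = c := by
  refine ⟨∑ i ∈ Finset.range (n + 1), ∑ A : Finset W, inclusion f G n i A (c i A), ?_⟩
  have h : ∀ i A, components f G n (inclusion f G n i A (c i A)) =
      Pi.single i (Pi.single A (c i A)) := by
    intro i A
    by_cases h : i + A.card = n
    · rw [components_inclusion f G n i A h]
    · rw [inclusion_of_ne f G n i A h, hc i A h, LinearMap.zero_apply, map_zero, Pi.single_zero,
        Pi.single_zero]
  simp only [map_sum, h]
  funext i A
  simp only [Finset.sum_apply]
  by_cases hi : i < n + 1
  · rw [Finset.sum_eq_single i, Finset.sum_eq_single A]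
    · rw [Pi.single_eq_same, Pi.single_eq_same]
    · intro B _ hB
      rw [Pi.single_eq_same, Pi.single_eq_of_ne hB.symm]
    · exact fun h => absurd (Finset.mem_univ _) h
    · intro i' _ hi
      refine Finset.sum_eq_zero fun B _ => ?_
      rw [Pi.single_eq_of_ne hi.symm, Pi.zero_apply]
    · exact fun h => absurd (Finset.mem_range.2 hi) h
  · rw [hc i A (by omega)]
    refine Finset.sum_eq_zero fun i' hi' => Finset.sum_eq_zero fun B _ => ?_
    rw [Finset.mem_range] at hi'
    rw [Pi.single_eq_of_ne (by omega), Pi.zero_apply]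

end Tensor

end Koszul

namespace Koszul

/-! ### Bases of the tensor product -/

section Basis

variable {R : Type u} {W : Type} [CommRing R] [LinearOrder W] [Fintype W] (f : W → R)
  (G : ChainComplex (ModuleCat.{u} R) ℕ) {ι : ℕ → Type} [∀ n, Finite (ι n)]
  (b : ∀ n, Module.Basis (ι n) R (G.X n))

/-- The index set of a basis of the tensor product of a complex of free modules with the Koszul
complex. -/
abbrev TensorIndex (W : Type) (ι : ℕ → Type) (n : ℕ) : Type :=
  Σ p : {p : ℕ × Finset W // p.1 + p.2.card = n}, ι p.1.1

omit [LinearOrder W] in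
theorem finite_tensorIndex (ι : ℕ → Type) [∀ n, Finite (ι n)] (n : ℕ) :
    Finite (TensorIndex W ι n) := by
  have : Finite {p : ℕ × Finset W // p.1 + p.2.card = n} := by
    -- The subset `A` determines `i`, since `i + A.card = n`.
    refine Finite.of_injective (fun p => p.1.2) ?_
    rintro ⟨⟨i, A⟩, h⟩ ⟨⟨i', A'⟩, h'⟩ (rfl : A = A')
    have : i = i' := by dsimp only at h h'; omega
    subst this
    rfl
  infer_instance

/-- The coordinates of an element of the tensor product with the Koszul complex. -/
noncomputable def coordinates (n : ℕ) :
    (G ⊗ complex f).X n →ₗ[R] (TensorIndex W ι n → R) where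
  toFun z x := (b x.1.1.1).repr (components f G n z x.1.1.1 x.1.1.2) x.2
  map_add' y z := by
    funext x
    simp
  map_smul' r z := by
    funext x
    simp

theorem coordinates_bijective (n : ℕ) : Function.Bijective (coordinates f G b n) := by
  constructor
  · intro y z h
    refine components_injective f G n (funext fun i => funext fun A => ?_)
    by_cases hi : i + A.card = n
    · refine (b i).repr.injective (Finsupp.ext fun a => ?_)
      exact congrFun h ⟨⟨(i, A), hi⟩, a⟩
    · rw [isHomogeneousFamily_components f G n y i A hi,
        isHomogeneousFamily_components f G n z i A hi]
  · intro c
    obtain ⟨z, hz⟩ := exists_components_eq f G n (fun i A => if h : i + A.card = n then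
      (b i).repr.symm (Finsupp.equivFunOnFinite.symm fun a => c ⟨⟨(i, A), h⟩, a⟩) else 0)
      (fun i A h => dif_neg h)
    refine ⟨z, ?_⟩
    funext ⟨⟨⟨i, A⟩, h⟩, a⟩
    change (b i).repr (components f G n z i A) a = _
    rw [hz]
    dsimp only at h ⊢
    rw [dif_pos h, LinearEquiv.apply_symm_apply, Finsupp.equivFunOnFinite_symm_apply_apply]

/-- The basis of the tensor product of a complex of free modules with the Koszul complex. -/
noncomputable def tensorBasis (n : ℕ) :
    Module.Basis (TensorIndex W ι n) R ((G ⊗ complex f).X n) :=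
  have := finite_tensorIndex (W := W) ι n
  Module.Basis.ofEquivFun (LinearEquiv.ofBijective _ (coordinates_bijective f G b n))

theorem tensorBasis_repr (n : ℕ) (z : (G ⊗ complex f).X n) (x : TensorIndex W ι n) :
    (tensorBasis f G b n).repr z x =
      (b x.1.1.1).repr (components f G n z x.1.1.1 x.1.1.2) x.2 := by
  have := finite_tensorIndex (W := W) ι n
  rw [tensorBasis, Module.Basis.ofEquivFun_repr_apply]
  rfl

theorem components_tensorBasis (n : ℕ) (x : TensorIndex W ι n) :
    components f G n (tensorBasis f G b n x) =
      Pi.single x.1.1.1 (Pi.single x.1.1.2 (b x.1.1.1 x.2)) := by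
  rw [← components_inclusion f G n _ _ x.1.2]
  congr 1
  refine (tensorBasis f G b n).repr.injective (Finsupp.ext fun y => ?_)
  obtain ⟨⟨⟨i, A⟩, h⟩, a⟩ := x
  obtain ⟨⟨⟨i', A'⟩, h'⟩, a'⟩ := y
  classical
  rw [Module.Basis.repr_self, tensorBasis_repr, components_inclusion f G n _ _ h]
  dsimp only
  by_cases hi : i' = i
  · subst hi
    by_cases hA : A' = A
    · subst hA
      rw [Pi.single_eq_same, Pi.single_eq_same, Module.Basis.repr_self, Finsupp.single_apply,
        Finsupp.single_apply]
      simp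
    · rw [Pi.single_eq_same, Pi.single_eq_of_ne hA, map_zero, Finsupp.single_eq_of_ne]
      · rfl
      · intro h
        simp only [Sigma.mk.injEq, Subtype.mk.injEq, Prod.mk.injEq] at h
        exact hA h.1.2
  · rw [Pi.single_eq_of_ne hi, Pi.zero_apply, map_zero, Finsupp.single_eq_of_ne]
    · rfl
    · intro h
      simp only [Sigma.mk.injEq, Subtype.mk.injEq, Prod.mk.injEq] at h
      exact hi h.1.1

end Basis

/-! ### Minimality of the tensor product -/

section Minimal

variable {R : Type u} {W : Type} [CommRing R] [LinearOrder W] [Fintype W] (f : W → R)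
  (G : ChainComplex (ModuleCat.{u} R) ℕ)

theorem range_d_le_smul_top (I : Ideal R) (hf : ∀ w, f w ∈ I)
    (hG : ∀ n, LinearMap.range (G.d (n + 1) n).hom ≤ I • (⊤ : Submodule R (G.X n))) (n : ℕ) :
    LinearMap.range ((G ⊗ complex f).d (n + 1) n).hom ≤
      I • (⊤ : Submodule R ((G ⊗ complex f).X n)) := by
  rintro _ ⟨z, rfl⟩
  rw [← sum_inclusion_components f G n (((G ⊗ complex f).d (n + 1) n).hom z), components_d]
  refine sum_mem fun i _ => sum_mem fun A _ => ?_
  refine Submodule.smul_top_le_comap_smul_top I (inclusion f G n i A) ?_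
  rw [totalDifferential_apply]
  refine add_mem (hG i ⟨_, rfl⟩) (Submodule.smul_mem _ _ (sum_mem fun j _ => ?_))
  exact Submodule.smul_mem_smul (Ideal.mul_mem_left _ _ (hf j)) Submodule.mem_top

end Minimal

/-! ### Homogeneity of the differential -/

section Homogeneous

variable {σ : Type*} {k : Type*} [CommRing k] {W : Type} [LinearOrder W] [Fintype W] {w : σ → ℤ}
  {f : W → MvPolynomial σ k} {e : W → ℤ}
  {G : ℕ → Type*} [∀ i, AddCommGroup (G i)] [∀ i, Module (MvPolynomial σ k) (G i)]
  {d : ∀ i, G (i + 1) →ₗ[MvPolynomial σ k] G i} {ι : ℕ → Type*}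
  {b : ∀ n, Module.Basis (ι n) (MvPolynomial σ k) (G n)} {deg : ∀ n, ι n → ℤ}

open MvPolynomial

theorem isWeightedHomogeneous_neg_one_pow_mul (n : ℕ) {p : MvPolynomial σ k} {m : ℤ}
    (hp : IsWeightedHomogeneous w p m) : IsWeightedHomogeneous w ((-1) ^ n * p) m := by
  rcases neg_one_pow_eq_or (MvPolynomial σ k) n with h | h
  · rwa [h, one_mul]
  · rw [h, neg_one_mul]
    exact hp.neg

theorem isWeightedHomogeneous_repr_totalDifferential_single
    (hf : ∀ j, IsWeightedHomogeneous w (f j) (e j))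
    (hd : ∀ n i j, IsWeightedHomogeneous w ((b n).repr (d n (b (n + 1) j)) i)
      (deg (n + 1) j - deg n i))
    (i : ℕ) (A : Finset W) (a : ι i) (i' : ℕ) (A' : Finset W) (a' : ι i') :
    IsWeightedHomogeneous w ((b i').repr
        (totalDifferential f d (Pi.single i (Pi.single A (b i a))) i' A') a')
      ((deg i a + ∑ j ∈ A, e j) - (deg i' a' + ∑ j ∈ A', e j)) := by
  classical
  rw [totalDifferential_apply, map_add, Finsupp.add_apply]
  refine IsWeightedHomogeneous.add ?_ ?_
  · by_cases hi : i' + 1 = i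
    · subst hi
      rw [Pi.single_eq_same]
      by_cases hA : A' = A
      · subst hA
        rw [Pi.single_eq_same]
        convert hd i' a' a using 1
        ring
      · rw [Pi.single_eq_of_ne hA, map_zero, map_zero]
        exact isWeightedHomogeneous_zero _ _ _
    · rw [Pi.single_eq_of_ne hi, Pi.zero_apply, map_zero, map_zero]
      exact isWeightedHomogeneous_zero _ _ _
  · rw [map_smul, Finsupp.smul_apply, smul_eq_mul]
    refine isWeightedHomogeneous_neg_one_pow_mul i' ?_
    rw [contract_apply, map_sum, Finsupp.finsetSum_apply]
    refine IsWeightedHomogeneous.sum _ _ _ fun j hj => ?_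
    rw [map_smul, Finsupp.smul_apply, smul_eq_mul, mul_assoc]
    refine isWeightedHomogeneous_neg_one_pow_mul _ ?_
    by_cases hi : i' = i
    · subst hi
      rw [Pi.single_eq_same]
      by_cases hA : insert j A' = A
      · subst hA
        rw [Pi.single_eq_same, Module.Basis.repr_self, Finsupp.single_apply]
        by_cases ha : a = a'
        · subst ha
          rw [if_pos rfl, mul_one, Finset.sum_insert (Finset.mem_compl.1 hj)]
          convert hf j using 1
          ring
        · rw [if_neg ha, mul_zero]
          exact isWeightedHomogeneous_zero _ _ _
      · rw [Pi.single_eq_of_ne hA, map_zero, Finsupp.zero_apply, mul_zero]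
        exact isWeightedHomogeneous_zero _ _ _
    · rw [Pi.single_eq_of_ne hi, Pi.zero_apply, map_zero, Finsupp.zero_apply, mul_zero]
      exact isWeightedHomogeneous_zero _ _ _

end Homogeneous

/-! ### Regularity from prime ideals -/

section Regular

variable {R W : Type*} [CommRing R] {f : W → R}

/-- Lifted to `R`, the relation says `f j * q` lies in the prime ideal `I + (f_s)`; as `f j` does
not, `q` does. -/
theorem exists_eq_sum_of_isPrime [DecidableEq W] {I : Ideal R} (s : Finset W) (j : W)
    (hp : (I ⊔ Ideal.span (f '' s)).IsPrime) (hj : f j ∉ I ⊔ Ideal.span (f '' s))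
    (m : R ⧸ I) (g : W → R ⧸ I) (h : f j • m = ∑ i ∈ s, f i • g i) :
    ∃ g' : W → R ⧸ I, m = ∑ i ∈ s, f i • g' i := by
  obtain ⟨q, rfl⟩ := Ideal.Quotient.mk_surjective m
  choose g₀ hg₀ using fun i => Ideal.Quotient.mk_surjective (g i)
  have h1 : f j * q - ∑ i ∈ s, f i * g₀ i ∈ I := by
    rw [← Ideal.Quotient.eq, map_sum, map_mul]
    simp only [map_mul, hg₀]
    exact h
  have h2 : f j * q ∈ I ⊔ Ideal.span (f '' s) := by
    rw [← sub_add_cancel (f j * q) (∑ i ∈ s, f i * g₀ i)]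
    refine add_mem (Ideal.mem_sup_left h1) (Ideal.mem_sup_right (sum_mem fun i hi => ?_))
    exact Ideal.mul_mem_right _ _ (Ideal.subset_span ⟨i, hi, rfl⟩)
  obtain ⟨x, hx, y, hy, hxy⟩ := Submodule.mem_sup.1 ((hp.mem_or_mem h2).resolve_left hj)
  obtain ⟨c, rfl⟩ := (Submodule.mem_span_image_finset_iff_exists_fun' R).1 hy
  refine ⟨fun i => Ideal.Quotient.mk I (c i), ?_⟩
  rw [← hxy, map_add, Ideal.Quotient.eq_zero_iff_mem.2 hx, zero_add, map_sum]
  refine Finset.sum_congr rfl fun i _ => ?_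
  rw [smul_eq_mul, mul_comm, map_mul]
  rfl

/-- Each initial segment of the list spans a prime ideal that misses the next element; primality of
the last ideal also makes it proper. -/
theorem isRegular_map_of_isPrime (hp : ∀ T : Set W, (Ideal.span (f '' T)).IsPrime)
    (hf : ∀ (T : Set W) (j : W), j ∉ T → f j ∉ Ideal.span (f '' T)) (l : List W) (hl : l.Nodup) :
    RingTheory.Sequence.IsRegular R (l.map f) := by
  have hspan : ∀ l : List W, Ideal.ofList (l.map f) = Ideal.span (f '' {w | w ∈ l}) := by
    intro l
    unfold Ideal.ofList
    congr 1
    ext x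
    simp
  refine ⟨⟨fun i hi => ?_⟩, ?_⟩
  · rw [isSMulRegular_quotient_iff_mem_of_smul_mem]
    intro x hx
    rw [smul_eq_mul, Ideal.mul_top, ← List.map_take, hspan] at hx ⊢
    rw [List.getElem_map, smul_eq_mul] at hx
    rw [List.length_map] at hi
    refine ((hp _).mem_or_mem hx).resolve_left (hf _ _ ?_)
    intro h
    have h : l[i] ∈ l.take i := h
    rw [List.mem_take_iff_getElem] at h
    obtain ⟨j, hj, hji⟩ := h
    have := (List.Nodup.getElem_inj_iff hl).1 hji
    omega
  · rw [smul_eq_mul, Ideal.mul_top, hspan]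
    exact (hp _).ne_top.symm

end Regular

end Koszul

/-! ### Assembling the minimal graded free resolution -/

open Koszul in
/-- The tensor product of a minimal graded free resolution of `k[x] ⧸ I` with the Koszul complex
of a family of homogeneous polynomials without constant term that is regular on `k[x] ⧸ I`. -/
theorem IsMinimalGradedFreeResolution.tensor_koszul {σ W : Type} {k : Type u} [Field k]
    [LinearOrder W] [Finite W] {w : σ → ℤ} {I J : Ideal (MvPolynomial σ k)}
    {f : W → MvPolynomial σ k} {e : W → ℤ}
    (hfe : ∀ j, MvPolynomial.IsWeightedHomogeneous w (f j) (e j))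
    (hfm : ∀ j, f j ∈ Ideal.span (Set.range (MvPolynomial.X : σ → MvPolynomial σ k)))
    (hJ : J = I ⊔ Ideal.span (Set.range f))
    (hreg : ∀ (s : Finset W) (j : W), j ∉ s → ∀ (m : MvPolynomial σ k ⧸ I)
      (g : W → MvPolynomial σ k ⧸ I), f j • m = ∑ i ∈ s, f i • g i →
      ∃ g' : W → MvPolynomial σ k ⧸ I, m = ∑ i ∈ s, f i • g' i)
    {G : ChainComplex (ModuleCat.{u} (MvPolynomial σ k)) ℕ}
    (hG : IsMinimalGradedFreeResolution w I G) :
    IsMinimalGradedFreeResolution w J (G ⊗ complex f) := by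
  classical
  cases nonempty_fintype W
  obtain ⟨ι, hι, b, deg, ε, hdeg, hε, hsurj, hex0, hex, hmin⟩ := hG
  have hIJ : I ≤ J := hJ ▸ le_sup_left
  have hex' : ∀ i x, differentials G i x = 0 → ∃ y, differentials G (i + 1) y = x :=
    fun i x h => (hex i x).1 h
  have hd : ∀ i x, differentials G i (differentials G (i + 1) x) = 0 :=
    fun i x => (hex i _).2 ⟨x, rfl⟩
  have hd0 : ∀ x, ε (differentials G 0 x) = 0 := fun x => (hex0 _).2 ⟨x, rfl⟩
  have hex0' : ∀ x, ε x = 0 → ∃ y, differentials G 0 y = x := fun x h => (hex0 x).1 h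
  let π : (MvPolynomial σ k ⧸ I) →ₗ[MvPolynomial σ k] (MvPolynomial σ k ⧸ J) :=
    (Ideal.Quotient.factorₐ (MvPolynomial σ k) hIJ).toLinearMap
  have hπ : ∀ q, π (Ideal.Quotient.mk I q) = Ideal.Quotient.mk J q := fun q => rfl
  -- Degree 0 of the tensor product is `G_0 ⊗ e_∅`, so the augmentation is `ε` followed by reduction
  -- modulo `J`.
  let ε' : (G ⊗ complex f).X 0 →ₗ[MvPolynomial σ k] MvPolynomial σ k ⧸ J :=
    π ∘ₗ ε ∘ₗ LinearMap.proj (R := MvPolynomial σ k) (φ := fun _ : Finset W => G.X 0) ∅ ∘ₗ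
      LinearMap.proj (R := MvPolynomial σ k) (φ := fun i => Finset W → G.X i) 0 ∘ₗ
      components f G 0
  have hε' : ∀ z, ε' z = π (ε (components f G 0 z 0 ∅)) := fun z => rfl
  refine ⟨TensorIndex W ι, fun n => finite_tensorIndex ι n, tensorBasis f G b,
    fun n x => deg x.1.1.1 x.2 + ∑ j ∈ x.1.1.2, e j, ε', ?_, ?_, ?_, ?_, ?_,
    range_d_le_smul_top f G _ hfm hmin⟩
  · intro n x y
    rw [tensorBasis_repr, components_d, components_tensorBasis]
    exact isWeightedHomogeneous_repr_totalDifferential_single hfe hdeg _ _ _ _ _ _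
  · rintro ⟨⟨⟨i, A⟩, h⟩, a⟩
    obtain ⟨rfl, hA⟩ : i = 0 ∧ A.card = 0 := by dsimp only at h; omega
    obtain rfl := Finset.card_eq_zero.1 hA
    obtain ⟨p, hp, hpε⟩ := hε a
    refine ⟨p, ?_, ?_⟩
    · dsimp only
      rwa [Finset.sum_empty, add_zero]
    · rw [hε', components_tensorBasis]
      dsimp only
      rw [Pi.single_eq_same, Pi.single_eq_same, hpε, hπ]
  · intro y
    obtain ⟨q, rfl⟩ := Ideal.Quotient.mk_surjective y
    obtain ⟨g, hg⟩ := hsurj (Ideal.Quotient.mk I q)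
    refine ⟨inclusion f G 0 0 ∅ g, ?_⟩
    rw [hε', components_inclusion f G 0 0 ∅ (by simp), Pi.single_eq_same, Pi.single_eq_same, hg, hπ]
  · intro z
    constructor
    · intro hz
      rw [hε'] at hz
      obtain ⟨q, hq⟩ := Ideal.Quotient.mk_surjective (ε (components f G 0 z 0 ∅))
      rw [← hq, hπ, Ideal.Quotient.eq_zero_iff_mem, hJ] at hz
      obtain ⟨x, hx, y, hy, hxy⟩ := Submodule.mem_sup.1 hz
      obtain ⟨c, rfl⟩ := (Submodule.mem_span_range_iff_exists_fun _).1 hy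
      obtain ⟨c', hc', hcz⟩ := exists_totalDifferential_eq_zero (G := fun i => G.X i) (f := f) (d := differentials G) ε
        hsurj hex0' (components f G 0 z 0 ∅) (fun i => Ideal.Quotient.mk I (c i)) (by
          rw [← hq, ← hxy, map_add, Ideal.Quotient.eq_zero_iff_mem.2 hx, zero_add, map_sum]
          refine Finset.sum_congr rfl fun i _ => ?_
          rw [smul_eq_mul, mul_comm, map_mul]
          rfl)
      obtain ⟨z', hz'⟩ := exists_components_eq f G 1 c' hc'
      refine ⟨z', components_injective f G 0 ?_⟩
      rw [components_d, hz']
      funext i A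
      by_cases h : i + A.card = 0
      · obtain ⟨rfl, hA⟩ : i = 0 ∧ A.card = 0 := by omega
        obtain rfl := Finset.card_eq_zero.1 hA
        exact hcz
      · rw [hc'.totalDifferential i A h, isHomogeneousFamily_components f G 0 z i A h]
    · rintro ⟨z', rfl⟩
      rw [hε', components_d, totalDifferential_apply, map_add, hd0, zero_add, pow_zero, one_smul,
        contract_apply, map_sum, map_sum]
      refine Finset.sum_eq_zero fun j _ => ?_
      rw [map_smul, map_smul]
      obtain ⟨q, hq⟩ := Ideal.Quotient.mk_surjective
        (π (ε (components f G 1 z' 0 (insert j ∅))))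
      rw [← hq]
      change Ideal.Quotient.mk J (sign _ j (insert j ∅) * f j * q) = 0
      rw [Ideal.Quotient.eq_zero_iff_mem, hJ]
      refine Ideal.mem_sup_right (Ideal.mul_mem_right _ _ (Ideal.mul_mem_left _ _ ?_))
      exact Ideal.subset_span ⟨j, rfl⟩
  · intro n z
    constructor
    · intro hz
      have hD : totalDifferential f (differentials G) (components f G (n + 1) z) = 0 := by
        rw [← components_d, hz, map_zero]
      obtain ⟨c, hc, hcz⟩ := exists_totalDifferential_eq (G := fun i => G.X i) ε hsurj hd hd0 hex' hex0' hreg n _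
        (isHomogeneousFamily_components f G (n + 1) z) hD
      obtain ⟨z', hz'⟩ := exists_components_eq f G (n + 2) c hc
      refine ⟨z', components_injective f G (n + 1) ?_⟩
      rw [components_d, hz', hcz]
    · rintro ⟨z', rfl⟩
      rw [← LinearMap.comp_apply, ← ModuleCat.hom_comp, HomologicalComplex.d_comp_d]
      rfl

/-! ### Apéry sets -/

namespace NumericalSemigroup

variable {S : AddSubmonoid ℕ}

theorem exists_mem_modEq (hS : ((S : Set ℕ)ᶜ).Finite) (i m : ℕ) (hm : 0 < m) :
    ∃ n ∈ S, n ≠ 0 ∧ n ≡ i [MOD m] := by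
  obtain ⟨B, hB⟩ := hS.bddAbove
  -- `B` bounds the gaps of `S`; adding `m * (B + 1)` to `i` passes it without changing the residue.
  refine ⟨i + m * (B + 1), ?_, ?_, ?_⟩
  · by_contra h
    have h1 : i + m * (B + 1) ≤ B := hB h
    have h2 : B + 1 ≤ m * (B + 1) := Nat.le_mul_of_pos_left _ hm
    omega
  · have h2 : B + 1 ≤ m * (B + 1) := Nat.le_mul_of_pos_left _ hm
    omega
  · simp [Nat.ModEq]

theorem mult_spec (hS : ((S : Set ℕ)ᶜ).Finite) : mult S ∈ S ∧ mult S ≠ 0 := by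
  obtain ⟨n, hn, hn0, -⟩ := exists_mem_modEq hS 0 1 one_pos
  exact Nat.sInf_mem (s := {n | n ∈ S ∧ n ≠ 0}) ⟨n, hn, hn0⟩

theorem mult_le {n : ℕ} (hn : n ∈ S) (h0 : n ≠ 0) : mult S ≤ n := Nat.sInf_le ⟨hn, h0⟩

theorem exists_mem_aperySet (hS : ((S : Set ℕ)ᶜ).Finite) (i : ℕ) :
    ∃ n, n ∈ aperySet S ∧ n ≡ i [MOD mult S] := by
  classical
  have hm := mult_spec hS
  have hex : ∃ n, n ∈ S ∧ n ≡ i [MOD mult S] := by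
    obtain ⟨n, hn, -, h⟩ := exists_mem_modEq hS i (mult S) (Nat.pos_of_ne_zero hm.2)
    exact ⟨n, hn, h⟩
  refine ⟨Nat.find hex, ⟨(Nat.find_spec hex).1, ?_⟩, (Nat.find_spec hex).2⟩
  intro s hs h
  have h1 := (Nat.find_spec hex).2
  rw [h] at h1
  have h2 : s ≡ i [MOD mult S] := by simpa [Nat.ModEq] using h1
  have h3 := Nat.find_min' hex ⟨hs, h2⟩
  have := hm.2
  omega

theorem aperyGen_spec (hS : ((S : Set ℕ)ᶜ).Finite) (i : Fin (mult S)) (hi : (i : ℕ) ≠ 0) :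
    aperyGen S i ∈ aperySet S ∧ aperyGen S i ≡ i [MOD mult S] := by
  rw [aperyGen, if_neg hi]
  exact Nat.sInf_mem (s := {n | n ∈ aperySet S ∧ n ≡ (i : ℕ) [MOD mult S]})
    (exists_mem_aperySet hS i)

theorem aperyGen_pos (hS : ((S : Set ℕ)ᶜ).Finite) (i : Fin (mult S)) : 0 < aperyGen S i := by
  by_cases hi : (i : ℕ) = 0
  · rw [aperyGen, if_pos hi]
    exact Nat.pos_of_ne_zero (mult_spec hS).2
  · refine Nat.pos_of_ne_zero fun h => hi ?_
    have h1 := (aperyGen_spec hS i hi).2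
    rw [h, Nat.ModEq, Nat.zero_mod, Nat.mod_eq_of_lt i.2] at h1
    exact h1.symm

/-- An Apéry element is least in its residue class: a smaller `x ∈ S` in that class would give `y =
(x + t m) + m` with `x + t m ∈ S`. -/
theorem not_lt_of_modEq_of_mem_aperySet (hS : ((S : Set ℕ)ᶜ).Finite) {x y : ℕ}
    (hx : x ∈ S) (hy : y ∈ aperySet S) (h : x ≡ y [MOD mult S]) : ¬ x < y := by
  intro hlt
  obtain ⟨t, ht⟩ := (Nat.modEq_iff_dvd' hlt.le).1 h
  cases t with
  | zero =>
    rw [mul_zero] at ht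
    omega
  | succ t =>
    refine hy.2 (x + t * mult S) (add_mem hx ?_) ?_
    · rw [← smul_eq_mul]
      exact AddSubmonoid.nsmul_mem _ (mult_spec hS).1 t
    · have : mult S * (t + 1) = t * mult S + mult S := by ring
      omega

theorem exists_aperyGen_eq (hS : ((S : Set ℕ)ᶜ).Finite) {n : ℕ} (hn : n ∈ aperySet S)
    (h0 : n ≠ 0) : ∃ i : Fin (mult S), aperyGen S i = n := by
  have hm := mult_spec hS
  have hi : n % mult S ≠ 0 := by
    intro h
    exact not_lt_of_modEq_of_mem_aperySet hS (zero_mem S) hn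
      (by rw [Nat.ModEq, h, Nat.zero_mod]) (Nat.pos_of_ne_zero h0)
  refine ⟨⟨n % mult S, Nat.mod_lt _ (Nat.pos_of_ne_zero hm.2)⟩, ?_⟩
  obtain ⟨h1, h2⟩ := aperyGen_spec hS ⟨n % mult S, Nat.mod_lt _ (Nat.pos_of_ne_zero hm.2)⟩ hi
  replace h2 := h2.trans (Nat.mod_modEq n (mult S))
  have h3 := not_lt_of_modEq_of_mem_aperySet hS h1.1 hn h2
  have h4 := not_lt_of_modEq_of_mem_aperySet hS hn.1 h1 h2.symm
  omega

theorem mult_mem_minimalGenerators (hS : ((S : Set ℕ)ᶜ).Finite) :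
    mult S ∈ minimalGenerators S := by
  refine ⟨(mult_spec hS).1, (mult_spec hS).2, fun s hs t ht hs0 ht0 h => ?_⟩
  have := mult_le hs hs0
  omega

/-- A summand in `S` of an Apéry element is again an Apéry element, so both nonzero summands of a
decomposable `a_w` are among the `a_i`. -/
theorem exists_aperyGen_add_eq (hS : ((S : Set ℕ)ᶜ).Finite) (w : ExtraIndex S) :
    ∃ u v : Fin (mult S), aperyGen S u + aperyGen S v = aperyGen S w := by
  have hw0 : ((w : Fin (mult S)) : ℕ) ≠ 0 := by
    intro h
    refine w.2 ?_
    rw [aperyGen, if_pos h]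
    exact mult_mem_minimalGenerators hS
  have hw := (aperyGen_spec hS w hw0).1
  have hw' := w.2
  simp only [minimalGenerators, Set.mem_ofPred_eq, not_and, not_forall, not_not] at hw'
  obtain ⟨s, hs, t, ht, hs0, ht0, h⟩ := hw' hw.1 (aperyGen_pos hS w).ne'
  obtain ⟨u, rfl⟩ := exists_aperyGen_eq hS (n := s)
    ⟨hs, fun s' hs' h' => hw.2 (s' + t) (add_mem hs' ht) (by omega)⟩ hs0
  obtain ⟨v, rfl⟩ := exists_aperyGen_eq hS (n := t)
    ⟨ht, fun t' ht' h' => hw.2 (aperyGen S u + t') (add_mem hs ht') (by omega)⟩ ht0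
  exact ⟨u, v, h.symm⟩

end NumericalSemigroup

open NumericalSemigroup
theorem proposition4p1 (k : Type u) [Field k] (S : AddSubmonoid ℕ)
    (hS : ((S : Set ℕ)ᶜ).Finite) :
    (∀ w : ExtraIndex S, ∃ u v : Fin (mult S),
      aperyGen S u + aperyGen S v = aperyGen S w) ∧
    ∀ (u v : ExtraIndex S → Fin (mult S))
      (f : ExtraIndex S → MvPolynomial (Fin (mult S)) k),
      (∀ w, aperyGen S (u w) + aperyGen S (v w) = aperyGen S w) →
      (∀ w, f w = MvPolynomial.X (w : Fin (mult S)) -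
        MvPolynomial.X (u w) * MvPolynomial.X (v w)) →
      (∀ l : List (ExtraIndex S), l.Nodup → (∀ w, w ∈ l) →
        RingTheory.Sequence.IsRegular (MvPolynomial (Fin (mult S)) k) (l.map f)) ∧
      ∀ G : ChainComplex (ModuleCat.{u} (MvPolynomial (Fin (mult S)) k)) ℕ,
        IsMinimalGradedFreeResolution (fun i => (aperyGen S i : ℤ)) (toricIdealExt k S) G →
        IsMinimalGradedFreeResolution (fun i => (aperyGen S i : ℤ)) (aperyIdeal k S)
          (G ⊗ Koszul.complex f) := by
  refine ⟨exists_aperyGen_add_eq hS, fun u v f huv hf => ?_⟩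
  have ha := aperyGen_pos hS
  have hu : ∀ w, aperyGen S (u w) < aperyGen S w := fun w => by
    have := huv w
    have := ha (v w)
    omega
  have hv : ∀ w, aperyGen S (v w) < aperyGen S w := fun w => by
    have := huv w
    have := ha (u w)
    omega
  constructor
  · intro l hl _
    -- Regularity on `R` itself is the case `P = ⊥`.
    refine Koszul.isRegular_map_of_isPrime (fun T => ?_) (fun T j hj h => ?_) l hl
    · have := isPrime_map_rename_sup_span hu hv hf ⊥ T
      rwa [Ideal.map_bot, bot_sup_eq] at this
    · refine notMem_map_rename_sup_span hf huv ha ⊥ (fun q hq => ?_) T j hj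
        (Ideal.mem_sup_right h)
      rw [Ideal.mem_bot.1 hq, map_zero]
  · intro G hG
    -- The kernel of a map to the domain `k[t]` is prime, and so is its contraction.
    have hP : (toricIdeal k S).IsPrime := by
      have : (aperyIdeal k S).IsPrime := RingHom.ker_isPrime _
      exact Ideal.comap_isPrime _ _
    have hJ : aperyIdeal k S = toricIdealExt k S ⊔ Ideal.span (Set.range f) :=
      ker_aeval_eq_map_rename_sup_span hu hv hf huv _ rfl
    have hreg : ∀ (s : Finset (ExtraIndex S)) (j : ExtraIndex S), j ∉ s →
        ∀ (x : MvPolynomial (Fin (mult S)) k ⧸ toricIdealExt k S)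
        (g : ExtraIndex S → MvPolynomial (Fin (mult S)) k ⧸ toricIdealExt k S),
        f j • x = ∑ i ∈ s, f i • g i →
        ∃ g' : ExtraIndex S → MvPolynomial (Fin (mult S)) k ⧸ toricIdealExt k S,
          x = ∑ i ∈ s, f i • g' i := by
      intro s j hj
      refine Koszul.exists_eq_sum_of_isPrime s j
        (isPrime_map_rename_sup_span hu hv hf (toricIdeal k S) s)
        (notMem_map_rename_sup_span hf huv ha (toricIdeal k S) (fun q hq => ?_) s j
          (by simpa using hj))
      have h : MvPolynomial.aeval (R := k) (fun i => (Polynomial.X : Polynomial k) ^ aperyGen S i)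
        (MvPolynomial.rename Subtype.val q) = 0 := hq
      rwa [MvPolynomial.aeval_rename] at h
    refine IsMinimalGradedFreeResolution.tensor_koszul (I := toricIdealExt k S)
      (J := aperyIdeal k S) (f := f) (e := fun w => (aperyGen S w : ℤ))
      (fun w => ?_) (fun w => ?_) hJ hreg hG
    · rw [hf]
      refine (MvPolynomial.isWeightedHomogeneous_X k _ _).sub ?_
      have := (MvPolynomial.isWeightedHomogeneous_X k
        (fun i => (aperyGen S i : ℤ)) (u w)).mul (MvPolynomial.isWeightedHomogeneous_X k _ (v w))
      rwa [← Nat.cast_add, huv] at this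
    · rw [hf]
      exact sub_mem (Ideal.subset_span ⟨_, rfl⟩)
        (Ideal.mul_mem_left _ _ (Ideal.subset_span ⟨_, rfl⟩))
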